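/- Fix an integer $d\ge 3$ and write $\mathbb{I}=[0,1]$. A $d$-dimensional copula $C$ is the restriction to $\mathbb{I}^d$ of the distribution function of a probability measure $\mu_C$ on $\mathbb{I}^d$ with uniform univariate marginals, so $C(\mathbf{x})=\mu_C([\mathbf{0},\mathbf{x}])$; $\mu_{C^{1:d-1}}$ denotes the law of the first $d-1$ coordinates under $\mu_C$. A (normalized) Archimedean generator is a continuous, non-increasing function $\psi:[0,\infty)\to[0,1]$ with $\psi(0)=1$, $\lim_{z\to\infty}\psi(z)=0=:\psi(\infty)$, $\psi$ strictly decreasing on $[0,\inf\{z\in[0,\infty]:\psi(z)=0\}]$, and $\psi(1)=\tfrac12$; its pseudo-inverse is $\varphi(y)=\inf\{z\in[0,\infty]:\psi(z)=y\}$, $y\in\mathbb{I}$. A copula $C$ is Archimedean with generator $\psi$ if $C(\mathbf{x})=\psi(\varphi(x_1)+\dots+\varphi(x_d))$ for all $\mathbf{x}\in\mathbb{I}^d$. Let $C,C_1,C_2,\dots$ be $d$-dimensional Archimedean copulas with normalized generators $\psi,\psi_1,\psi_2,\dots$ and pseudo-inverses $\varphi,\varphi_1,\varphi_2,\dots$,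 and let $K_C,K_{C_1},K_{C_2},\dots$ be arbitrary versions of their $(d-1)$-Markov kernels, i.e. regular conditional distributions of the last coordinate given the first $d-1$ coordinates. Say that $(C_n)$ converges weakly conditional to $C$ if there is a Borel set $\Lambda\subseteq\mathbb{I}^{d-1}$ with $\mu_{C^{1:d-1}}(\Lambda)=1$ such that for every $\mathbf{x}\in\Lambda$ the probability measures $K_{C_n}(\mathbf{x},\cdot)$ converge weakly to $K_C(\mathbf{x},\cdot)$. Then the generators $\psi,\psi_1,\psi_2,\dots$ are $d-2$ times continuously differentiable on $(0,\infty)$, the left-hand derivatives $D^-\psi^{(d-2)},D^-\psi_n^{(d-2)}$ exist on $(0,\infty)$, the measures $\mu_{C^{1:d-1}},\mu_{C_n^{1:d-1}}$ have densities $c^{1:d-1},c_n^{1:d-1}$ with respect to Lebesgue measure $\lambda_{d-1}$ on $\mathbb{I}^{d-1}$, and the following assertions are equivalent: 1. $(C_n)_{n\in\mathbb{N}}$ converges uniformly to $C$. 2. $(\varphi_n)_{n\in\mathbb{N}}$ converges pointwise to $\varphi$ on $(0,1]$. 3. $(\psi_n)_{n\in\mathbb{N}}$ converges uniformly to $\psi$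 on $[0,\infty)$. 4. $(\psi_n^{(m)})_{n\in\mathbb{N}}$ converges pointwise to $\psi^{(m)}$ on $(0,\infty)$ for every $m\in\{1,2,\dots,d-2\}$, and $(D^-\psi_n^{(d-2)})_{n\in\mathbb{N}}$ converges pointwise to $D^-\psi^{(d-2)}$ at every continuity point of $D^-\psi^{(d-2)}$ in $(0,\infty)$. 5. $(C_n)_{n\in\mathbb{N}}$ converges weakly conditional to $C$, and $(c_n^{1:d-1})_{n\in\mathbb{N}}$ converges to $c^{1:d-1}$ $\lambda_{d-1}$-almost everywhere in $\mathbb{I}^{d-1}$. -/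

import Mathlib

open Set Filter Topology MeasureTheory ProbabilityTheory unitInterval
open scoped ENNReal

/-- A `d`-dimensional copula, given by its `d`-stochastic measure: a probability measure on
`[0,1]^d` all of whose univariate marginals are uniform on `[0,1]`. -/
structure Copula (d : ℕ) where
  measure : Measure (Fin d → I)
  isProbabilityMeasure : IsProbabilityMeasure measure
  map_eval : ∀ i : Fin d, measure.map (fun x => x i) = volume

namespace Copula

/-- The copula as a function: `C(x) = μ_C([0,x])`
(`Iic x` is `[0,x₁] × ⋯ × [0,x_d]` for the coordinatewise order of `[0,1]^d`). -/
noncomputable def cdf {d : ℕ} (C : Copula d) (x : Fin d → I) : ℝ :=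
  C.measure.real (Iic x)

/-- `μ_{C^{1:d-1}}` for `d = k + 1`: the law of the first `d - 1` coordinates. -/
noncomputable def initMarginal {k : ℕ} (C : Copula (k + 1)) : Measure (Fin k → I) :=
  C.measure.map (fun x i => x i.castSucc)

/-- `μ_C`, regarded as a measure on `[0,1]^{d-1} × [0,1]` for `d = k + 1`. -/
noncomputable def splitMeasure {k : ℕ} (C : Copula (k + 1)) : Measure ((Fin k → I) × I) :=
  C.measure.map (fun x => (fun i => x i.castSucc, x (Fin.last k)))

/-- `K` is (a version of) the `(d-1)`-Markov kernel of `C`, for `d = k + 1`: a regular conditional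
distribution of the last coordinate given the first `d - 1` coordinates. -/
def IsMarkovKernelOf {k : ℕ} (C : Copula (k + 1)) (K : Kernel (Fin k → I) I) : Prop :=
  C.splitMeasure.IsCondKernel K

/-- (A version of) the density `c^{1:d-1}` of `C^{1:d-1}` with respect to Lebesgue measure on
`[0,1]^{d-1}`, for `d = k + 1`. -/
noncomputable def initDensity {k : ℕ} (C : Copula (k + 1)) : (Fin k → I) → ℝ≥0∞ :=
  C.initMarginal.rnDeriv volume

/-- The conditional distribution `K(x, ·)`, as a probability measure on `[0,1]`. -/
def conditionalLaw {k : ℕ} (K : Kernel (Fin k → I) I) [hK : IsMarkovKernel K] (x : Fin k → I) :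
    ProbabilityMeasure I :=
  ⟨K x, hK.isProbabilityMeasure x⟩

/-- Weak conditional convergence of copulas with Markov kernels `Ks n` to the copula `C` with Markov
kernel `K`: for all `x` in a set of full `μ_{C^{1:d-1}}`-measure, the conditional distributions
`Ks n x` converge weakly to `K x`. -/
def WeaklyConditionalTendsto {k : ℕ} (Ks : ℕ → Kernel (Fin k → I) I)
    [∀ n, IsMarkovKernel (Ks n)] (C : Copula (k + 1)) (K : Kernel (Fin k → I) I)
    [IsMarkovKernel K] : Prop :=
  ∃ Λ : Set (Fin k → I), MeasurableSet Λ ∧ C.initMarginal Λ = 1 ∧ ∀ x ∈ Λ,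
    Tendsto (fun n => conditionalLaw (Ks n) x) atTop (𝓝 (conditionalLaw K x))

end Copula

/-- The extension of `ψ : [0,∞) → ℝ` to `[0,∞]` by `ψ(∞) = 0`
(values of `ψ` at negative reals are never used). -/
noncomputable def extendTop (ψ : ℝ → ℝ) (z : ℝ≥0∞) : ℝ :=
  if z = ∞ then 0 else ψ z.toReal

/-- The pseudo-inverse `φ(y) = inf {z ∈ [0,∞] : ψ(z) = y}`. -/
noncomputable def pseudoInverse (ψ : ℝ → ℝ) (y : ℝ) : ℝ≥0∞ :=
  sInf {z : ℝ≥0∞ | extendTop ψ z = y}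

/-- Normalized Archimedean generators `ψ : [0,∞) → [0,1]`. -/
structure IsArchimedeanGenerator (ψ : ℝ → ℝ) : Prop where
  continuousOn : ContinuousOn ψ (Ici 0)
  mapsTo : MapsTo ψ (Ici 0) (Icc 0 1)
  antitoneOn : AntitoneOn ψ (Ici 0)
  map_zero : ψ 0 = 1
  tendsto_atTop : Tendsto ψ atTop (𝓝 0)
  strictAntiOn : StrictAntiOn (extendTop ψ) (Icc 0 (sInf {z : ℝ≥0∞ | extendTop ψ z = 0}))
  normalized : ψ 1 = 1 / 2

/-- The left-hand derivative `D⁻g(z)`. -/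
noncomputable def leftDeriv (g : ℝ → ℝ) (z : ℝ) : ℝ :=
  derivWithin g (Iic z) z

namespace Copula

/-- `C` is Archimedean with (normalized) generator `ψ`:
`C(x) = ψ(φ(x₁) + ⋯ + φ(x_d))` on `[0,1]^d`. -/
structure IsArchimedeanWith {d : ℕ} (C : Copula d) (ψ : ℝ → ℝ) : Prop where
  generator : IsArchimedeanGenerator ψ
  cdf_eq : ∀ x : Fin d → I, C.cdf x = extendTop ψ (∑ i, pseudoInverse ψ (x i))

/-- The objects attached to `C` and `ψ` that involve derivatives exist (here `d = k + 1`): the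
derivatives of `ψ` up to order `d - 2` on `(0,∞)`, the left-hand derivative of `ψ^{(d-2)}` there,
and a density of `C^{1:d-1}`. -/
structure HasDerivativesAndDensity {k : ℕ} (C : Copula (k + 1)) (ψ : ℝ → ℝ) : Prop where
  contDiffOn : ContDiffOn ℝ ((k - 1 : ℕ) : ℕ∞) ψ (Ioi 0)
  left : ∀ z ∈ Ioi (0 : ℝ), DifferentiableWithinAt ℝ (iteratedDeriv (k - 1) ψ) (Iic z) z
  absolutelyContinuous : C.initMarginal ≪ volume

end Copula

/-! ### Convex functions on the half-line and their left-hand derivatives. -/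

section ConvexAnalysis

/-! Uniform convergence of the generators (assertion 3) is the hub: 1 ⇔ 3, 2 ⇔ 3, 3 ⇔ 4 and 3 → 5 →
1.

Regularity. Alternating differences of `ψ` are `μ_C`-masses of boxes, so `ψ` is `d`-monotone
(`IsArchimedeanWith.isMultiplyMonotone`). Hence the signed derivatives `(-1)^m ψ^{(m)}`, `m ≤ d-2`,
are nonnegative, decreasing and convex, and the last one has a left-hand derivative that jumps at
most countably often. Integrating these derivatives back one coordinate at a time shows that `A ↦
μ_C(A × [0,y])`, `y > 0`, has the explicit density `archimedeanDensity`; the case `y = 1` is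
`c^{1:d-1}`, and dividing by it gives the kernel.

Between 1, 2 and 3. `ψ` and `φ` form a Galois connection, so pointwise convergence passes between
them; Pólya's argument makes it uniform for generators, and equicontinuity makes it uniform for
copulas. To recover `ψ` from `C`, the normalization `ψ(1) = 1/2` and `C(u,u) = ψ(2φ(u))` fix the
limits at `2⁻ʲ`, addition extends them to dyadics, and monotonicity extends them to all points
(`tendsto_generator_of_tendsto_cdf`).

Between 3 and 4. Convergent convex functions have convergent left-hand derivatives at continuity
points of the limit (`tendsto_leftDeriv`), which is iterated up to order `d-1`. Conversely, first
derivatives are integrated from the normalization point 1.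

Between 3 and 5. The explicit densities converge off the null set where `∑ φ(xᵢ)`, shifted by
`φ(y)`, meets a jump; their quotients give the kernels. The step from 5 to 1 needs only that the
first `d-1` coordinates have densities: it is a Scheffé argument, Fatou being applied to
complementary integrands of total mass one. -/

theorem leftDeriv_eq_derivWithin_Iio (f : ℝ → ℝ) (z : ℝ) :
    leftDeriv f z = derivWithin f (Iio z) z := by
  rw [leftDeriv]
  by_cases H : DifferentiableWithinAt ℝ f (Iio z) z
  · exact (hasDerivWithinAt_Iio_iff_Iic.1 H.hasDerivWithinAt).derivWithin
      (uniqueDiffOn_Iic z z self_mem_Iic)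
  · rw [derivWithin_zero_of_not_differentiableWithinAt H,
      derivWithin_zero_of_not_differentiableWithinAt]
    exact fun h => H (h.mono Iio_subset_Iic_self)

theorem leftDeriv_congr {f g : ℝ → ℝ} (h : EqOn f g (Ioi 0)) {z : ℝ} (hz : 0 < z) :
    leftDeriv f z = leftDeriv g z :=
  Filter.EventuallyEq.derivWithin_eq
    (mem_nhdsWithin_of_mem_nhds (by filter_upwards [Ioi_mem_nhds hz] with x hx using h hx)) (h hz)

theorem leftDeriv_eq_deriv {f : ℝ → ℝ} {z : ℝ} (h : DifferentiableAt ℝ f z) :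
    leftDeriv f z = deriv f z :=
  h.derivWithin (uniqueDiffOn_Iic z z self_mem_Iic)

/-- Were convexity to fail, `f` minus a chord would have a positive interior maximum, and the
midpoint inequality is violated at the leftmost maximizer. -/
theorem convexOn_Ioi_of_midpoint {f : ℝ → ℝ} (hc : ContinuousOn f (Ioi 0))
    (hm : ∀ z > 0, ∀ h > 0, 2 * f (z + h) ≤ f z + f (z + h + h)) : ConvexOn ℝ (Ioi 0) f := by
  refine convexOn_of_slope_mono_adjacent (convex_Ioi 0) fun {x y z} hx hz hxy hyz => ?_
  by_contra! hlt
  set s := (f z - f x) / (z - x) with hs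
  set g : ℝ → ℝ := fun t => f t - (f x + (t - x) * s) with hg
  have hx0 : (0 : ℝ) < x := hx
  have hgx : g x = 0 := by simp [hg]
  have hgz : g z = 0 := by
    have : z - x ≠ 0 := by linarith
    simp only [hg, hs]; field_simp; ring
  have hgy : 0 < g y := by
    have h1 : 0 < y - x := by linarith
    have h2 : 0 < z - y := by linarith
    have h3 : 0 < z - x := by linarith
    rw [div_lt_div_iff₀ h2 h1] at hlt
    have : g y = ((f y - f x) * (z - x) - (y - x) * (f z - f x)) / (z - x) := by
      simp only [hg, hs]; field_simp; ring
    rw [this]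
    apply div_pos _ h3
    nlinarith
  have hsub : Icc x z ⊆ Ioi 0 := fun t ht => lt_of_lt_of_le hx0 ht.1
  have hgc : ContinuousOn g (Icc x z) :=
    (hc.mono hsub).sub (by fun_prop)
  obtain ⟨c₀, hc₀, hmax⟩ := isCompact_Icc.exists_isMaxOn ⟨y, hxy.le, hyz.le⟩ hgc
  have hM : 0 < g c₀ := hgy.trans_le (hmax ⟨hxy.le, hyz.le⟩)
  have hS : IsCompact {t | t ∈ Icc x z ∧ g t = g c₀} := by
    have := hgc.preimage_isClosed_of_isClosed isClosed_Icc (isClosed_singleton (x := g c₀))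
    exact isCompact_Icc.of_isClosed_subset this inter_subset_left
  -- The least maximizer makes the inequality at `c - h` strict.
  obtain ⟨c, ⟨hcI, hcM⟩, hcl⟩ := hS.exists_isLeast ⟨c₀, hc₀, rfl⟩
  have hcx : x < c := lt_of_le_of_ne hcI.1 (by rintro rfl; linarith)
  have hcz : c < z := lt_of_le_of_ne hcI.2 (by rintro rfl; linarith)
  set h := min (c - x) (z - c)
  have hh : 0 < h := lt_min (by linarith) (by linarith)
  have hh1 : h ≤ c - x := min_le_left _ _
  have hh2 : h ≤ z - c := min_le_right _ _
  have h1 : c - h ∈ Icc x z := ⟨by linarith, by linarith⟩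
  have h2 : c + h ∈ Icc x z := ⟨by linarith, by linarith⟩
  have h3 : g (c - h) < g c₀ :=
    lt_of_le_of_ne (hmax h1) fun he => by have := hcl ⟨h1, he⟩; linarith
  have h4 : g (c + h) ≤ g c₀ := hmax h2
  have h5 := hm (c - h) (hsub h1) h hh
  rw [show c - h + h = c by ring] at h5
  simp only [hg] at h3 h4 hcM
  nlinarith

variable {f : ℝ → ℝ}

theorem ConvexOn.slope_le_leftDeriv_Ioi (hf : ConvexOn ℝ (Ioi 0) f) {x y : ℝ} (hx : 0 < x)
    (hxy : x < y) : slope f x y ≤ leftDeriv f y := by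
  rw [leftDeriv_eq_derivWithin_Iio]
  exact hf.slope_le_leftDeriv_of_mem_interior hx (by simpa using hx.trans hxy) hxy

theorem ConvexOn.leftDeriv_le_slope_Ioi (hf : ConvexOn ℝ (Ioi 0) f) {x y : ℝ} (hx : 0 < x)
    (hxy : x < y) : leftDeriv f x ≤ slope f x y := by
  rw [leftDeriv_eq_derivWithin_Iio]
  exact (hf.leftDeriv_le_rightDeriv_of_mem_interior (by simpa using hx)).trans
    (hf.rightDeriv_le_slope_of_mem_interior (by simpa using hx) (hx.trans hxy) hxy)

theorem ConvexOn.monotoneOn_leftDeriv_Ioi (hf : ConvexOn ℝ (Ioi 0) f) :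
    MonotoneOn (leftDeriv f) (Ioi 0) := fun x hx y hy hxy => by
  rcases hxy.eq_or_lt with rfl | h
  · exact le_rfl
  · exact (hf.leftDeriv_le_slope_Ioi hx h).trans (hf.slope_le_leftDeriv_Ioi hx h)

theorem ConvexOn.hasDerivWithinAt_leftDeriv_Ioi (hf : ConvexOn ℝ (Ioi 0) f) {z : ℝ} (hz : 0 < z) :
    HasDerivWithinAt f (leftDeriv f z) (Iic z) z := by
  rw [leftDeriv_eq_derivWithin_Iio, ← hasDerivWithinAt_Iio_iff_Iic]
  exact hf.hasDerivWithinAt_leftDeriv_of_mem_interior (by simpa using hz)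

theorem ConvexOn.hasDerivAt_of_rightDeriv_le (hf : ConvexOn ℝ (Ioi 0) f) {z : ℝ} (hz : 0 < z)
    (h : derivWithin f (Ioi z) z ≤ leftDeriv f z) : HasDerivAt f (leftDeriv f z) z := by
  have hi : z ∈ interior (Ioi (0 : ℝ)) := by simpa using hz
  have h1 := hf.hasDerivWithinAt_leftDeriv_Ioi hz
  have h2 := hf.hasDerivWithinAt_rightDeriv_of_mem_interior hi
  have h3 := hf.leftDeriv_le_rightDeriv_of_mem_interior hi
  rw [← leftDeriv_eq_derivWithin_Iio] at h3
  rw [le_antisymm h h3, hasDerivWithinAt_Ioi_iff_Ici] at h2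
  have := h1.union h2
  rwa [Iic_union_Ici, hasDerivWithinAt_univ] at this

/-- A convex function on `(0,∞)` is differentiable off a countable set. -/
theorem ConvexOn.exists_countable_hasDerivAt (hf : ConvexOn ℝ (Ioi 0) f) :
    ∃ s : Set ℝ, s.Countable ∧ ∀ z, 0 < z → z ∉ s → HasDerivAt f (leftDeriv f z) z := by
  -- The exceptional set consists of the jumps of the monotone left-hand derivative; elsewhere the
  -- right-hand derivative at `z` is at most `leftDeriv f w` for every `w > z`, which tends to
  -- `leftDeriv f z`.
  refine ⟨_, hf.monotoneOn_leftDeriv_Ioi.countable_not_continuousWithinAt, fun z hz hzs => ?_⟩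
  refine hf.hasDerivAt_of_rightDeriv_le hz ?_
  have hc : ContinuousWithinAt (leftDeriv f) (Ioi 0) z := by
    by_contra h; exact hzs ⟨hz, h⟩
  have hc' := hc.mono (Ioi_subset_Ioi hz.le)
  refine ge_of_tendsto hc' ?_
  filter_upwards [self_mem_nhdsWithin] with w hw
  exact (hf.rightDeriv_le_slope_of_mem_interior (by simpa using hz) (hz.trans hw) hw).trans
    (hf.slope_le_leftDeriv_Ioi hz hw)

/-- If all differences `f - f (· + h)` of a convex function are convex, it has no kinks. -/
theorem ConvexOn.differentiableOn_of_convexOn_sub (hf : ConvexOn ℝ (Ioi 0) f)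
    (hd : ∀ h > 0, ConvexOn ℝ (Ioi 0) fun z => f z - f (z + h)) : DifferentiableOn ℝ f (Ioi 0) := by
  intro z hz
  have hz0 : (0 : ℝ) < z := hz
  obtain ⟨s, hs, hsd⟩ := hf.exists_countable_hasDerivAt
  -- Shifting by `z - y` moves a possible kink at `z` to the differentiability point `y`. There it
  -- enters with a minus sign, so a genuine kink would make `f - f (· + (z - y))` concave at `y`.
  obtain ⟨y, hys, hy0, hyz⟩ := (hs.dense_compl ℝ).exists_between hz0
  have hi : ∀ {w : ℝ}, 0 < w → w ∈ interior (Ioi (0 : ℝ)) := fun h => by simpa using h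
  have hdy := hsd y hy0 hys
  have hg := hd (z - y) (by linarith)
  have hyz' : y + (z - y) = z := by ring
  have hL := hf.hasDerivWithinAt_leftDeriv_Ioi hz0
  have hR := hf.hasDerivWithinAt_rightDeriv_of_mem_interior (hi hz0)
  have hs1 : HasDerivWithinAt (fun w => w + (z - y)) 1 (Iio y) y :=
    ((hasDerivAt_id y).add_const _).hasDerivWithinAt
  have hs2 : HasDerivWithinAt (fun w => w + (z - y)) 1 (Ioi y) y :=
    ((hasDerivAt_id y).add_const _).hasDerivWithinAt
  have hL' : HasDerivWithinAt (fun w => f (w + (z - y))) (leftDeriv f z * 1) (Iio y) y :=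
    HasDerivWithinAt.comp (h₂ := f) (s' := Iic z) y (by simpa [hyz'] using hL) hs1
      fun w hw => by simp only [mem_Iio, mem_Iic] at *; linarith
  have hR' : HasDerivWithinAt (fun w => f (w + (z - y))) (derivWithin f (Ioi z) z * 1) (Ioi y) y :=
    HasDerivWithinAt.comp (h₂ := f) (s' := Ioi z) y (by simpa [hyz'] using hR) hs2
      fun w hw => by simp only [mem_Ioi] at *; linarith
  have e1 := (hdy.hasDerivWithinAt.sub hL').derivWithin (uniqueDiffWithinAt_Iio y)
  have e2 := (hdy.hasDerivWithinAt.sub hR').derivWithin (uniqueDiffWithinAt_Ioi y)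
  have h3 := hg.leftDeriv_le_rightDeriv_of_mem_interior (hi hy0)
  have h4 : derivWithin f (Ioi z) z ≤ leftDeriv f z := by
    have e1' : derivWithin (fun w => f w - f (w + (z - y))) (Iio y) y = _ := e1
    have e2' : derivWithin (fun w => f w - f (w + (z - y))) (Ioi y) y = _ := e2
    rw [e1', e2'] at h3; linarith
  exact (hf.hasDerivAt_of_rightDeriv_le hz0 h4).differentiableAt.differentiableWithinAt

theorem tendsto_slope {fs : ℕ → ℝ → ℝ} {p q : ℝ} (hp : Tendsto (fun n => fs n p) atTop (𝓝 (f p)))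
    (hq : Tendsto (fun n => fs n q) atTop (𝓝 (f q))) :
    Tendsto (fun n => slope (fs n) p q) atTop (𝓝 (slope f p q)) := by
  simp only [slope_def_field]
  exact (hq.sub hp).div_const _

/-- Left-hand derivatives of pointwise convergent convex functions converge continuously at the
continuity points of the limit. -/
theorem tendsto_leftDeriv {fs : ℕ → ℝ → ℝ} (hfs : ∀ n, ConvexOn ℝ (Ioi 0) (fs n))
    (hf : ConvexOn ℝ (Ioi 0) f)
    (hlim : ∀ z > 0, Tendsto (fun n => fs n z) atTop (𝓝 (f z))) {z : ℝ} (hz : 0 < z)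
    (hc : ContinuousAt (leftDeriv f) z) {zs : ℕ → ℝ} (hzs : Tendsto zs atTop (𝓝 z)) :
    Tendsto (fun n => leftDeriv (fs n) (zs n)) atTop (𝓝 (leftDeriv f z)) := by
  refine tendsto_order.2 ⟨fun a ha => ?_, fun b hb => ?_⟩
  -- The slope over a fixed `[p, q]` left of `z` exceeds `a` and passes to the limit; monotonicity
  -- of the derivative carries the bound from `q` to the moving point `zs n`. The upper bound is
  -- symmetric.
  · have h1 : ∀ᶠ p in 𝓝[<] z, a < leftDeriv f p ∧ 0 < p ∧ p < z :=
      ((hc.eventually_const_lt ha).filter_mono nhdsWithin_le_nhds).and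
        (((lt_mem_nhds hz).filter_mono nhdsWithin_le_nhds).and self_mem_nhdsWithin)
    obtain ⟨p, hap, hp0, hpz⟩ := h1.exists
    obtain ⟨q, hpq, hqz⟩ := exists_between hpz
    have h2 : a < slope f p q := hap.trans_le (hf.leftDeriv_le_slope_Ioi hp0 hpq)
    have h3 := tendsto_slope (hlim p hp0) (hlim q (hp0.trans hpq))
    filter_upwards [h3.eventually_const_lt h2, hzs.eventually_const_lt hqz] with n hn hn'
    exact hn.trans_le (((hfs n).slope_le_leftDeriv_Ioi hp0 hpq).trans
      ((hfs n).monotoneOn_leftDeriv_Ioi (hp0.trans hpq) ((hp0.trans hpq).trans hn') hn'.le))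
  · have h1 : ∀ᶠ q in 𝓝[>] z, leftDeriv f q < b ∧ z < q :=
      ((hc.eventually_lt_const hb).filter_mono nhdsWithin_le_nhds).and self_mem_nhdsWithin
    obtain ⟨q, hqb, hzq⟩ := h1.exists
    obtain ⟨p, hzp, hpq⟩ := exists_between hzq
    have hp0 := hz.trans hzp
    have h2 : slope f p q < b := (hf.slope_le_leftDeriv_Ioi hp0 hpq).trans_lt hqb
    have h3 := tendsto_slope (hlim p hp0) (hlim q (hp0.trans hpq))
    filter_upwards [h3.eventually_lt_const h2, hzs.eventually_lt_const hzp,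
      hzs.eventually_const_lt hz] with n hn hn' hn''
    exact (((hfs n).monotoneOn_leftDeriv_Ioi hn'' hp0 hn'.le).trans
      ((hfs n).leftDeriv_le_slope_Ioi hp0 hpq)).trans_lt hn

theorem ConvexOn.integral_leftDeriv (hf : ConvexOn ℝ (Ioi 0) f) {p b : ℝ} (hp : 0 < p)
    (hpb : p ≤ b) :
    IntervalIntegrable (leftDeriv f) volume p b ∧ ∫ s in p..b, leftDeriv f s = f b - f p := by
  obtain ⟨s, hs, hsd⟩ := hf.exists_countable_hasDerivAt
  have hsub : Icc p b ⊆ Ioi 0 := fun t ht => hp.trans_le ht.1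
  have hi : IntervalIntegrable (leftDeriv f) volume p b :=
    (hf.monotoneOn_leftDeriv_Ioi.mono (by rwa [uIcc_of_le hpb])).intervalIntegrable
  exact ⟨hi, integral_eq_of_hasDerivAt_off_countable_of_le f (leftDeriv f) hpb hs
    ((hf.continuousOn isOpen_Ioi).mono hsub) (fun x hx => hsd x (hp.trans hx.1.1) hx.2) hi⟩

theorem ConvexOn.leftDeriv_nonpos_of_antitoneOn (hf : ConvexOn ℝ (Ioi 0) f)
    (ha : AntitoneOn f (Ioi 0)) {z : ℝ} (hz : 0 < z) : leftDeriv f z ≤ 0 := by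
  refine (hf.leftDeriv_le_slope_Ioi hz (lt_add_one z)).trans ?_
  rw [slope_def_field]
  have := ha hz (hz.trans (lt_add_one z)) (lt_add_one z).le
  simpa using this

theorem ConvexOn.tendsto_leftDeriv_atTop (hf : ConvexOn ℝ (Ioi 0) f)
    (ha : AntitoneOn f (Ioi 0)) (h0 : Tendsto f atTop (𝓝 0)) :
    Tendsto (leftDeriv f) atTop (𝓝 0) := by
  have h1 : Tendsto (fun z => f (z + 1) - f z) atTop (𝓝 0) := by
    simpa using (h0.comp (tendsto_atTop_add_const_right _ 1 tendsto_id)).sub h0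
  have h2 : Tendsto (fun z => f z - f (z + -1)) atTop (𝓝 0) := by
    simpa using h0.sub (h0.comp (tendsto_atTop_add_const_right _ (-1) tendsto_id))
  refine tendsto_of_tendsto_of_tendsto_of_le_of_le' h2 tendsto_const_nhds ?_ ?_
  · filter_upwards [eventually_gt_atTop 1] with z hz
    have := hf.slope_le_leftDeriv_Ioi (x := z + -1) (y := z) (by linarith) (by linarith)
    rwa [slope_def_field, show z - (z + -1) = 1 by ring, div_one] at this
  · filter_upwards [eventually_gt_atTop 0] with z hz
    exact hf.leftDeriv_nonpos_of_antitoneOn ha hz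

/-- The fundamental theorem is applied on the compact intervals `[p n, b n]`, which exhaust `(a,
∞)`, because at `a = 0` the derivative may be unbounded. -/
theorem ConvexOn.lintegral_neg_leftDeriv (hf : ConvexOn ℝ (Ioi 0) f)
    (ha : AntitoneOn f (Ioi 0)) (h0 : Tendsto f atTop (𝓝 0)) {a : ℝ} (ha0 : 0 ≤ a)
    (hc : ContinuousWithinAt f (Ioi a) a) :
    ∫⁻ s in Ioi a, ENNReal.ofReal (-leftDeriv f s) = ENNReal.ofReal (f a) := by
  set ν := (volume : Measure ℝ).withDensity fun s => ENNReal.ofReal (-leftDeriv f s)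
  let p : ℕ → ℝ := fun n => a + 1 / ((n : ℝ) + 1)
  let b : ℕ → ℝ := fun n => a + 1 + n
  have hp0 : ∀ n, 0 < p n := fun n => by positivity
  have hpb : ∀ n, p n ≤ b n := fun n => by
    have : 1 / ((n : ℝ) + 1) ≤ 1 := by
      rw [div_le_one (by positivity)]; linarith [(Nat.cast_nonneg n : (0 : ℝ) ≤ n)]
    have := (Nat.cast_nonneg n : (0 : ℝ) ≤ n)
    simp only [p, b]; linarith
  have hpl : Tendsto p atTop (𝓝 a) := by
    simpa [p] using (tendsto_one_div_add_atTop_nhds_zero_nat (𝕜 := ℝ)).const_add a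
  have hbl : Tendsto b atTop atTop :=
    tendsto_atTop_add_const_left _ _ tendsto_natCast_atTop_atTop
  have hpa : Antitone p := fun m n hmn => by
    have : (m : ℝ) ≤ n := by exact_mod_cast hmn
    simp only [p]; gcongr
  have hbm : Monotone b := fun m n hmn => by
    have : (m : ℝ) ≤ n := by exact_mod_cast hmn
    simp only [b]; gcongr
  have hν : ∀ n, ν (Ioc (p n) (b n)) = ENNReal.ofReal (f (p n) - f (b n)) := fun n => by
    obtain ⟨hi, he⟩ := hf.integral_leftDeriv (hp0 n) (hpb n)
    rw [withDensity_apply _ measurableSet_Ioc, ← ofReal_integral_eq_lintegral_ofReal]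
    · rw [← intervalIntegral.integral_of_le (hpb n), intervalIntegral.integral_neg, he, neg_sub]
    · exact ((intervalIntegrable_iff_integrableOn_Ioc_of_le (hpb n)).1 hi).neg
    · filter_upwards [ae_restrict_mem measurableSet_Ioc] with s hs
      have := hf.leftDeriv_nonpos_of_antitoneOn ha ((hp0 n).trans hs.1)
      simpa using this
  have hU : ⋃ n, Ioc (p n) (b n) = Ioi a := by
    ext s
    simp only [mem_iUnion, mem_Ioc, mem_Ioi]
    constructor
    · rintro ⟨n, hn, -⟩
      refine lt_of_le_of_lt ?_ hn
      simp only [p]; have : 0 ≤ 1 / ((n : ℝ) + 1) := by positivity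
      linarith
    · intro hs
      exact ((hpl.eventually_lt_const hs).and (hbl.eventually_ge_atTop s)).exists
  have hm : Monotone fun n => Ioc (p n) (b n) := fun m n hmn => Ioc_subset_Ioc (hpa hmn) (hbm hmn)
  have h1 := tendsto_measure_iUnion_atTop (μ := ν) hm
  rw [hU, withDensity_apply _ measurableSet_Ioi] at h1
  have h2 : Tendsto (fun n => ν (Ioc (p n) (b n))) atTop (𝓝 (ENNReal.ofReal (f a))) := by
    simp only [hν]
    refine ENNReal.tendsto_ofReal ?_
    have h3 : Tendsto (fun n => f (p n)) atTop (𝓝 (f a)) :=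
      hc.tendsto.comp (tendsto_nhdsWithin_iff.2 ⟨hpl, Eventually.of_forall fun n => by
        simp only [mem_Ioi, p]; have : 0 < 1 / ((n : ℝ) + 1) := by positivity
        linarith⟩)
    simpa using h3.sub (h0.comp hbl)
  exact tendsto_nhds_unique h1 h2

end ConvexAnalysis

/-! ### Multiply monotone functions. -/

section MultiplyMonotone

/-- Slopes from a fixed point `p` near `z` are continuous at `z` and bound the left-hand derivative
nearby: from below if `p < z`, from above if `p > z`. -/
theorem ConvexOn.continuousAt_leftDeriv {f : ℝ → ℝ} (hf : ConvexOn ℝ (Ioi 0) f) {z : ℝ}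
    (hz : 0 < z) (hd : DifferentiableAt ℝ f z) : ContinuousAt (leftDeriv f) z := by
  have hs : Tendsto (slope f z) (𝓝[≠] z) (𝓝 (leftDeriv f z)) := by
    rw [leftDeriv_eq_deriv hd]; exact hasDerivAt_iff_tendsto_slope.1 hd.hasDerivAt
  have hfc : ContinuousAt f z := hd.continuousAt
  refine tendsto_order.2 ⟨fun a ha => ?_, fun b hb => ?_⟩
  · have h1 : ∀ᶠ p in 𝓝[<] z, a < slope f z p ∧ 0 < p ∧ p < z :=
      ((hs.eventually_const_lt ha).filter_mono
        (nhdsWithin_mono _ fun x (hx : x < z) => hx.ne)).and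
        (((lt_mem_nhds hz).filter_mono nhdsWithin_le_nhds).and self_mem_nhdsWithin)
    obtain ⟨p, hap, hp0, hpz⟩ := h1.exists
    have hc : ContinuousAt (slope f p) z := by
      simp only [slope_fun_def_field]
      exact (hfc.sub continuousAt_const).div (by fun_prop) (by linarith)
    rw [slope_comm] at hap
    filter_upwards [hc.eventually_const_lt hap, lt_mem_nhds hpz] with w hw hpw
    exact hw.trans_le (hf.slope_le_leftDeriv_Ioi hp0 hpw)
  · have h1 : ∀ᶠ p in 𝓝[>] z, slope f z p < b ∧ z < p :=
      ((hs.eventually_lt_const hb).filter_mono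
        (nhdsWithin_mono _ fun x (hx : z < x) => hx.ne')).and self_mem_nhdsWithin
    obtain ⟨p, hap, hpz⟩ := h1.exists
    have hc : ContinuousAt (slope f p) z := by
      simp only [slope_fun_def_field]
      exact (hfc.sub continuousAt_const).div (by fun_prop) (by linarith)
    rw [slope_comm] at hap
    filter_upwards [hc.eventually_lt_const hap, gt_mem_nhds hpz, lt_mem_nhds hz] with w hw hpw h0
    rw [slope_comm] at hw
    exact (hf.leftDeriv_le_slope_Ioi h0 hpw).trans_lt hw

/-- `f` is `m`-monotone on `(0,∞)`: all its iterated differences of order at most `m`, taken with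
alternating signs, are nonnegative. -/
def IsMultiplyMonotone : ℕ → (ℝ → ℝ) → Prop
  | 0, f => ∀ z > 0, 0 ≤ f z
  | m + 1, f => (∀ z > 0, 0 ≤ f z) ∧ ∀ h > 0, IsMultiplyMonotone m fun z => f z - f (z + h)

namespace IsMultiplyMonotone

variable {f : ℝ → ℝ} {m : ℕ}

theorem nonneg (hf : IsMultiplyMonotone m f) {z : ℝ} (hz : 0 < z) : 0 ≤ f z := by
  cases m with
  | zero => exact hf z hz
  | succ m => exact hf.1 z hz

theorem congr {g : ℝ → ℝ} (hf : IsMultiplyMonotone m f) (h : EqOn f g (Ioi 0)) :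
    IsMultiplyMonotone m g := by
  induction m generalizing f g with
  | zero => exact fun z hz => h hz ▸ hf z hz
  | succ m ih =>
    refine ⟨fun z hz => h hz ▸ hf.1 z hz, fun s hs => ih (hf.2 s hs) fun z (hz : 0 < z) => ?_⟩
    simp only [h (show z ∈ Ioi 0 from hz), h (show z + s ∈ Ioi 0 from add_pos hz hs)]

theorem const_mul (hf : IsMultiplyMonotone m f) {c : ℝ} (hc : 0 ≤ c) :
    IsMultiplyMonotone m fun z => c * f z := by
  induction m generalizing f with
  | zero => exact fun z hz => mul_nonneg hc (hf z hz)
  | succ m ih =>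
    refine ⟨fun z hz => mul_nonneg hc (hf.1 z hz), fun s hs => ?_⟩
    simpa only [mul_sub] using ih (hf.2 s hs)

theorem of_tendsto {fs : ℕ → ℝ → ℝ} (hfs : ∀ n, IsMultiplyMonotone m (fs n))
    (h : ∀ z > 0, Tendsto (fun n => fs n z) atTop (𝓝 (f z))) : IsMultiplyMonotone m f := by
  induction m generalizing f fs with
  | zero => exact fun z hz => ge_of_tendsto' (h z hz) fun n => hfs n z hz
  | succ m ih =>
    exact ⟨fun z hz => ge_of_tendsto' (h z hz) fun n => (hfs n).1 z hz, fun s hs =>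
      ih (fun n => (hfs n).2 s hs) fun z hz => (h z hz).sub (h _ (add_pos hz hs))⟩

theorem convexOn (hf : IsMultiplyMonotone (m + 2) f) (hc : ContinuousOn f (Ioi 0)) :
    ConvexOn ℝ (Ioi 0) f := by
  refine convexOn_Ioi_of_midpoint hc fun z hz h hh => ?_
  have := ((hf.2 h hh).2 h hh).nonneg hz
  simp only at this
  linarith

/-- The spare order makes every difference `f - f (· + h)` convex, which excludes kinks. -/
theorem differentiableOn (hf : IsMultiplyMonotone (m + 3) f) (hc : ContinuousOn f (Ioi 0)) :
    DifferentiableOn ℝ f (Ioi 0) :=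
  (hf.convexOn hc).differentiableOn_of_convexOn_sub fun h hh =>
    (hf.2 h hh).convexOn (hc.sub (hc.comp (by fun_prop) fun z (hz : 0 < z) => add_pos hz hh))

/-- The difference quotients `(f z - f (z + h)) / h` are `m`-monotone, and this class is a cone
closed under pointwise limits. -/
theorem neg_deriv (hf : IsMultiplyMonotone (m + 1) f) (hd : DifferentiableOn ℝ f (Ioi 0)) :
    IsMultiplyMonotone m fun z => -deriv f z := by
  refine of_tendsto (fs := fun n z => ((n : ℝ) + 1) * (f z - f (z + 1 / ((n : ℝ) + 1))))
    (fun n => (hf.2 _ (by positivity)).const_mul (by positivity)) fun z hz => ?_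
  have h1 := (hd.differentiableAt (Ioi_mem_nhds hz)).hasDerivAt.tendsto_slope_zero_right
  have h2 : Tendsto (fun n : ℕ => 1 / ((n : ℝ) + 1)) atTop (𝓝[>] 0) :=
    tendsto_nhdsWithin_iff.2 ⟨tendsto_one_div_add_atTop_nhds_zero_nat,
      Eventually.of_forall fun n => by simp only [mem_Ioi]; positivity⟩
  refine (h1.comp h2).neg.congr fun n => ?_
  simp only [Function.comp_apply, smul_eq_mul, one_div, inv_inv]
  ring

end IsMultiplyMonotone

/-- The iterated negated left-hand derivatives of `f`. -/
noncomputable def negLeftDerivIter (f : ℝ → ℝ) : ℕ → ℝ → ℝ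
  | 0 => f
  | m + 1 => fun z => -leftDeriv (negLeftDerivIter f m) z

/-- Each derivative costs one order. As long as three orders remain, the current iterate is
differentiable with continuous derivative, so the left-hand derivative is the ordinary one; the two
orders left at the end give convexity. -/
theorem IsMultiplyMonotone.negLeftDerivIter {f : ℝ → ℝ} (hc : ContinuousOn f (Ioi 0)) (m j : ℕ)
    (hf : IsMultiplyMonotone (j + 2 + m) f) :
    IsMultiplyMonotone (j + 2) (negLeftDerivIter f m) ∧
      ContinuousOn (_root_.negLeftDerivIter f m) (Ioi 0) ∧
      EqOn (_root_.negLeftDerivIter f m) (fun z => (-1) ^ m * iteratedDeriv m f z) (Ioi 0) := by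
  induction m generalizing j with
  | zero => exact ⟨hf, hc, fun z _ => by simp [_root_.negLeftDerivIter]⟩
  | succ m ih =>
    obtain ⟨h1, h2, h3⟩ := ih (j + 1) (by rwa [show j + 1 + 2 + m = j + 2 + (m + 1) by ring])
    have hd := h1.differentiableOn h2
    have hdz : ∀ z ∈ Ioi (0 : ℝ), DifferentiableAt ℝ (_root_.negLeftDerivIter f m) z :=
      fun z hz => hd.differentiableAt (Ioi_mem_nhds hz)
    refine ⟨(h1.neg_deriv hd).congr fun z hz => ?_, fun z hz => ?_, fun z hz => ?_⟩
    · simp only [_root_.negLeftDerivIter, leftDeriv_eq_deriv (hdz z hz)]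
    · exact ((h1.convexOn h2).continuousAt_leftDeriv hz (hdz z hz)).neg.continuousWithinAt
    · have h4 : deriv (_root_.negLeftDerivIter f m) z = (-1) ^ m * iteratedDeriv (m + 1) f z := by
        rw [iteratedDeriv_succ, ← deriv_const_mul_field]
        exact Filter.EventuallyEq.deriv_eq
          (by filter_upwards [Ioi_mem_nhds hz] with x hx using h3 hx)
      simp only [_root_.negLeftDerivIter, leftDeriv_eq_deriv (hdz z hz), h4]
      ring

/-- A function whose shifts are the survival functions of a measure is multiply monotone. -/
theorem isMultiplyMonotone_of_measureReal {Ω : Type*} [MeasurableSpace Ω] (μ : Measure Ω)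
    [IsFiniteMeasure μ] (m : ℕ) (f : ℝ → ℝ) (A : ℝ → Set Ω) (E : Fin m → ℝ → Set Ω)
    (hA : ∀ z, MeasurableSet (A z)) (hE : ∀ i z, MeasurableSet (E i z))
    (hanti : ∀ i, ∀ h > 0, E i h ⊆ E i 0)
    (hf : ∀ z > 0, ∀ s : Fin m → ℝ, (∀ i, 0 ≤ s i) →
      f (z + ∑ i, s i) = μ.real (A z ∩ ⋂ i, E i (s i))) : IsMultiplyMonotone m f := by
  have hI : ∀ (n : ℕ) (t : Fin (n + 1) → Set Ω), ⋂ i, t i = t 0 ∩ ⋂ i : Fin n, t i.succ :=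
    fun n t => by ext; simp [Fin.forall_fin_succ]
  have hnn : ∀ z > 0, 0 ≤ f z := fun z hz => by
    have := hf z hz (fun _ => 0) fun _ => le_rfl
    simp only [Finset.sum_const_zero, add_zero] at this
    rw [this]; exact measureReal_nonneg
  induction m generalizing f A with
  | zero => exact hnn
  | succ m ih =>
    refine ⟨hnn, fun h hh => ?_⟩
    -- Differencing in the first increment replaces `E 0 0` by `E 0 0 \ E 0 h`, which is absorbed
    -- into `A` and leaves one family fewer.
    have key : ∀ z > 0, ∀ s : Fin m → ℝ, (∀ i, 0 ≤ s i) →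
        f (z + ∑ i, s i) - f (z + ∑ i, s i + h) =
          μ.real ((A z ∩ (E 0 0 \ E 0 h)) ∩ ⋂ i, E (Fin.succ i) (s i)) := fun z hz s hs => by
      have h1 := hf z hz (Fin.cons 0 s) (Fin.cases le_rfl hs)
      have h2 := hf z hz (Fin.cons h s) (Fin.cases hh.le hs)
      simp only [Fin.sum_univ_succ, Fin.cons_zero, Fin.cons_succ, zero_add, hI]
        at h1 h2
      rw [h1, show z + ∑ i, s i + h = z + (h + ∑ i, s i) by ring, h2, ← measureReal_sdiff]
      · congr 1
        ext x
        simp only [Set.mem_sdiff, mem_inter_iff]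
        tauto
      · exact inter_subset_inter_right _ (inter_subset_inter_left _ (hanti 0 h hh))
      · exact (hA z).inter ((hE _ _).inter (MeasurableSet.iInter fun i => hE _ _))
    refine ih _ (fun z => A z ∩ (E 0 0 \ E 0 h)) (fun i => E i.succ)
      (fun z => (hA z).inter ((hE _ _).diff (hE _ _))) (fun i => hE _) (fun i => hanti _) key
      fun z hz => ?_
    have := key z hz (fun _ => 0) fun _ => le_rfl
    simp only [Finset.sum_const_zero, add_zero] at this
    rw [this]; exact measureReal_nonneg

end MultiplyMonotone

/-! ### Generators, pseudo-inverses and `d`-monotonicity. -/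

section Generator

theorem extendTop_top (ψ : ℝ → ℝ) : extendTop ψ ∞ = 0 := if_pos rfl

theorem extendTop_of_ne_top (ψ : ℝ → ℝ) {z : ℝ≥0∞} (hz : z ≠ ∞) :
    extendTop ψ z = ψ z.toReal := if_neg hz

theorem extendTop_ofReal (ψ : ℝ → ℝ) {z : ℝ} (hz : 0 ≤ z) :
    extendTop ψ (ENNReal.ofReal z) = ψ z := by
  rw [extendTop_of_ne_top ψ ENNReal.ofReal_ne_top, ENNReal.toReal_ofReal hz]

namespace IsArchimedeanGenerator

variable {ψ : ℝ → ℝ}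

theorem nonneg (h : IsArchimedeanGenerator ψ) {z : ℝ} (hz : 0 ≤ z) : 0 ≤ ψ z := (h.mapsTo hz).1

theorem le_one (h : IsArchimedeanGenerator ψ) {z : ℝ} (hz : 0 ≤ z) : ψ z ≤ 1 := (h.mapsTo hz).2

theorem extendTop_mem (h : IsArchimedeanGenerator ψ) (z : ℝ≥0∞) :
    extendTop ψ z ∈ Icc (0 : ℝ) 1 := by
  by_cases hz : z = ∞
  · simp [hz, extendTop_top]
  · rw [extendTop_of_ne_top ψ hz]; exact h.mapsTo ENNReal.toReal_nonneg

theorem extendTop_zero (h : IsArchimedeanGenerator ψ) : extendTop ψ 0 = 1 := by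
  rw [extendTop_of_ne_top ψ ENNReal.zero_ne_top, ENNReal.toReal_zero, h.map_zero]

theorem antitone_extendTop (h : IsArchimedeanGenerator ψ) : Antitone (extendTop ψ) := by
  intro a b hab
  by_cases hb : b = ∞
  · rw [hb, extendTop_top]; exact (h.extendTop_mem a).1
  · have ha : a ≠ ∞ := ne_top_of_le_ne_top hb hab
    rw [extendTop_of_ne_top ψ ha, extendTop_of_ne_top ψ hb]
    exact h.antitoneOn ENNReal.toReal_nonneg ENNReal.toReal_nonneg (ENNReal.toReal_mono hb hab)

theorem continuous_extendTop (h : IsArchimedeanGenerator ψ) : Continuous (extendTop ψ) := by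
  rw [continuous_iff_continuousAt]
  intro z
  by_cases hz : z = ∞
  · subst hz
    rw [ContinuousAt, extendTop_top]
    refine tendsto_order.2 ⟨fun a ha => Eventually.of_forall fun z =>
      ha.trans_le (h.extendTop_mem z).1, fun b hb => ?_⟩
    obtain ⟨N, hN0, hN⟩ := ((eventually_ge_atTop 0).and
      (h.tendsto_atTop.eventually_lt_const hb)).exists
    filter_upwards [lt_mem_nhds (ENNReal.ofReal_lt_top (r := N))] with w hw
    exact (h.antitone_extendTop hw.le).trans_lt (by rwa [extendTop_ofReal ψ hN0])
  · have h1 : Tendsto ENNReal.toReal (𝓝 z) (𝓝[Ici 0] z.toReal) :=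
      tendsto_nhdsWithin_iff.2 ⟨ENNReal.tendsto_toReal hz,
        Eventually.of_forall fun _ => ENNReal.toReal_nonneg⟩
    have h2 := (h.continuousOn z.toReal ENNReal.toReal_nonneg).tendsto.comp h1
    rw [ContinuousAt, extendTop_of_ne_top ψ hz]
    refine h2.congr' ?_
    filter_upwards [(isOpen_ne (x := (∞ : ℝ≥0∞))).mem_nhds hz] with w hw
    rw [extendTop_of_ne_top ψ hw, Function.comp_apply]

theorem extendTop_pseudoInverse (h : IsArchimedeanGenerator ψ) {y : ℝ} (hy : y ∈ Icc (0 : ℝ) 1) :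
    extendTop ψ (pseudoInverse ψ y) = y := by
  have hcl : IsClosed {z : ℝ≥0∞ | extendTop ψ z = y} :=
    isClosed_singleton.preimage h.continuous_extendTop
  have hne : {z : ℝ≥0∞ | extendTop ψ z = y}.Nonempty := by
    have := intermediate_value_univ (∞ : ℝ≥0∞) 0 h.continuous_extendTop
    rw [extendTop_top, h.extendTop_zero] at this
    exact this hy
  exact hcl.sInf_mem hne

theorem pseudoInverse_le (_h : IsArchimedeanGenerator ψ) (a : ℝ≥0∞) :
    pseudoInverse ψ (extendTop ψ a) ≤ a := sInf_le rfl

theorem strictAntiOn_pseudoInverse (h : IsArchimedeanGenerator ψ) :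
    StrictAntiOn (pseudoInverse ψ) (Icc 0 1) := by
  intro y hy y' hy' hlt
  by_contra! hle
  have := h.antitone_extendTop hle
  rw [h.extendTop_pseudoInverse hy, h.extendTop_pseudoInverse hy'] at this
  linarith

/-- The Galois connection between `ψ` and its pseudo-inverse. -/
theorem pseudoInverse_le_iff (h : IsArchimedeanGenerator ψ) {y : ℝ} (hy : y ∈ Icc (0 : ℝ) 1)
    (a : ℝ≥0∞) : pseudoInverse ψ y ≤ a ↔ extendTop ψ a ≤ y := by
  constructor
  · intro hle
    exact (h.antitone_extendTop hle).trans (h.extendTop_pseudoInverse hy).le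
  · intro hle
    by_contra! hlt
    -- `pseudoInverse ψ 0` is the right end of the interval on which `ψ` is strictly decreasing.
    have h0 : pseudoInverse ψ y ≤ pseudoInverse ψ 0 :=
      h.strictAntiOn_pseudoInverse.antitoneOn ⟨le_rfl, zero_le_one⟩ hy hy.1
    have := h.strictAntiOn ⟨zero_le, hlt.le.trans h0⟩ ⟨zero_le, h0⟩ hlt
    rw [h.extendTop_pseudoInverse hy] at this
    linarith

theorem lt_pseudoInverse_iff (h : IsArchimedeanGenerator ψ) {y : ℝ} (hy : y ∈ Icc (0 : ℝ) 1)
    (a : ℝ≥0∞) : a < pseudoInverse ψ y ↔ y < extendTop ψ a := by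
  rw [← not_le, h.pseudoInverse_le_iff hy, not_le]

theorem pseudoInverse_extendTop (h : IsArchimedeanGenerator ψ) {a : ℝ≥0∞}
    (ha : 0 < extendTop ψ a) : pseudoInverse ψ (extendTop ψ a) = a := by
  refine le_antisymm (h.pseudoInverse_le a) ?_
  by_contra! hlt
  have h0 : a < pseudoInverse ψ 0 := (h.lt_pseudoInverse_iff ⟨le_rfl, zero_le_one⟩ a).2 ha
  have := h.strictAntiOn ⟨zero_le, (hlt.trans h0).le⟩ ⟨zero_le, h0.le⟩ hlt
  rw [h.extendTop_pseudoInverse (h.extendTop_mem a)] at this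
  exact this.false

theorem pseudoInverse_one (h : IsArchimedeanGenerator ψ) : pseudoInverse ψ 1 = 0 := by
  have := h.pseudoInverse_le 0
  rw [h.extendTop_zero] at this
  simpa using this

theorem pseudoInverse_ne_top (h : IsArchimedeanGenerator ψ) {y : ℝ} (hy : y ∈ Ioc (0 : ℝ) 1) :
    pseudoInverse ψ y ≠ ∞ := fun he => by
  have := h.extendTop_pseudoInverse ⟨hy.1.le, hy.2⟩
  rw [he, extendTop_top] at this
  exact hy.1.ne this

theorem pseudoInverse_pos (h : IsArchimedeanGenerator ψ) {y : ℝ} (hy : y ∈ Ico (0 : ℝ) 1) :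
    0 < pseudoInverse ψ y := by
  rw [h.lt_pseudoInverse_iff ⟨hy.1, hy.2.le⟩, h.extendTop_zero]; exact hy.2

theorem map_toReal_pseudoInverse (h : IsArchimedeanGenerator ψ) {y : ℝ} (hy : y ∈ Ioc (0 : ℝ) 1) :
    ψ (pseudoInverse ψ y).toReal = y := by
  rw [← extendTop_of_ne_top ψ (h.pseudoInverse_ne_top hy),
    h.extendTop_pseudoInverse ⟨hy.1.le, hy.2⟩]

theorem toReal_pseudoInverse_map (h : IsArchimedeanGenerator ψ) {z : ℝ} (hz : 0 ≤ z)
    (hp : 0 < ψ z) : (pseudoInverse ψ (ψ z)).toReal = z := by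
  have := h.pseudoInverse_extendTop (a := ENNReal.ofReal z) (by rwa [extendTop_ofReal ψ hz])
  rw [extendTop_ofReal ψ hz] at this
  rw [this, ENNReal.toReal_ofReal hz]

theorem toReal_pseudoInverse_le_iff (h : IsArchimedeanGenerator ψ) {y : ℝ}
    (hy : y ∈ Ioc (0 : ℝ) 1) {z : ℝ} (hz : 0 ≤ z) :
    (pseudoInverse ψ y).toReal ≤ z ↔ ψ z ≤ y := by
  rw [← extendTop_ofReal ψ hz, ← h.pseudoInverse_le_iff ⟨hy.1.le, hy.2⟩,
    ENNReal.le_ofReal_iff_toReal_le (h.pseudoInverse_ne_top hy) hz]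

/-- `φ(ψ(a)) = a` can fail only where `ψ(a) = 0`, and a single such term makes both sides zero. -/
theorem extendTop_sum_pseudoInverse (h : IsArchimedeanGenerator ψ) {ι : Type*} [Fintype ι]
    (a : ι → ℝ≥0∞) :
    extendTop ψ (∑ i, pseudoInverse ψ (extendTop ψ (a i))) = extendTop ψ (∑ i, a i) := by
  by_cases hp : ∀ i, 0 < extendTop ψ (a i)
  · simp only [h.pseudoInverse_extendTop (hp _)]
  · push Not at hp
    obtain ⟨i, hi⟩ := hp
    have hi0 : extendTop ψ (a i) = 0 := le_antisymm hi (h.extendTop_mem _).1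
    have h1 : extendTop ψ (∑ i, a i) ≤ 0 :=
      (h.antitone_extendTop (Finset.single_le_sum (f := a) (fun _ _ => zero_le)
        (Finset.mem_univ i))).trans hi
    have h2 : extendTop ψ (∑ i, pseudoInverse ψ (extendTop ψ (a i))) ≤ 0 := by
      refine (h.antitone_extendTop (Finset.single_le_sum
        (f := fun i => pseudoInverse ψ (extendTop ψ (a i))) (fun _ _ => zero_le)
        (Finset.mem_univ i))).trans ?_
      simp only [hi0]
      exact (h.extendTop_pseudoInverse ⟨le_rfl, zero_le_one⟩).le
    exact (le_antisymm h2 (h.extendTop_mem _).1).trans (le_antisymm h1 (h.extendTop_mem _).1).symm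

end IsArchimedeanGenerator

/-- The value `ψ z`, for `z ≥ 0`, as a point of the unit interval. -/
noncomputable def generatorPoint (ψ : ℝ → ℝ) (z : ℝ) : I := projIcc 0 1 zero_le_one (ψ (max z 0))

theorem IsArchimedeanGenerator.coe_generatorPoint {ψ : ℝ → ℝ} (h : IsArchimedeanGenerator ψ)
    {z : ℝ} (hz : 0 ≤ z) : (generatorPoint ψ z : ℝ) = ψ z := by
  rw [generatorPoint, max_eq_left hz, projIcc_of_mem _ (h.mapsTo hz)]

theorem IsArchimedeanGenerator.continuous_generatorPoint {ψ : ℝ → ℝ}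
    (h : IsArchimedeanGenerator ψ) : Continuous (generatorPoint ψ) :=
  continuous_projIcc.comp (h.continuousOn.comp_continuous (by fun_prop) fun z => le_max_right z 0)

namespace Copula

attribute [instance] Copula.isProbabilityMeasure

theorem IsArchimedeanWith.cdf_generatorPoint {d : ℕ} {C : Copula d} {ψ : ℝ → ℝ}
    (hC : C.IsArchimedeanWith ψ) (a : Fin d → ℝ) (ha : ∀ i, 0 ≤ a i) :
    C.cdf (fun i => generatorPoint ψ (a i)) = ψ (∑ i, a i) := by
  rw [hC.cdf_eq]
  simp only [hC.generator.coe_generatorPoint (ha _)]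
  have := hC.generator.extendTop_sum_pseudoInverse fun i => ENNReal.ofReal (a i)
  simp only [extendTop_ofReal ψ (ha _)] at this
  rw [this, ← ENNReal.ofReal_sum_of_nonneg fun i _ => ha i,
    extendTop_ofReal ψ (Finset.sum_nonneg fun i _ => ha i)]

/-- The generator of a `d`-dimensional Archimedean copula is `d`-monotone. -/
theorem IsArchimedeanWith.isMultiplyMonotone {k : ℕ} {C : Copula (k + 1)} {ψ : ℝ → ℝ}
    (hC : C.IsArchimedeanWith ψ) : IsMultiplyMonotone (k + 1) ψ := by
  have hψ := hC.generator
  refine ⟨fun z hz => hψ.nonneg (le_of_lt hz), fun h hh => ?_⟩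
  have hm : ∀ (i : Fin (k + 1)) (y : I), MeasurableSet {x : Fin (k + 1) → I | x i ≤ y} :=
    fun i y => measurableSet_le (measurable_pi_apply i) measurable_const
  -- The first difference is taken in the coordinate that carries `z`. Built into the base set `A`,
  -- it raises the order from the `k` remaining coordinates to `k + 1`.
  refine isMultiplyMonotone_of_measureReal C.measure k _
    (fun z => {x | x 0 ≤ generatorPoint ψ z} \ {x | x 0 ≤ generatorPoint ψ (z + h)})
    (fun i s => {x | x i.succ ≤ generatorPoint ψ s}) (fun z => (hm _ _).diff (hm _ _))
    (fun i s => hm _ _) (fun i s hs x hx => ?_) fun z hz s hs => ?_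
  · refine le_trans (show x i.succ ≤ generatorPoint ψ s from hx) ?_
    rw [← Subtype.coe_le_coe, hψ.coe_generatorPoint hs.le, hψ.coe_generatorPoint le_rfl]
    exact hψ.antitoneOn self_mem_Ici hs.le hs.le
  · have hz0 : (0 : ℝ) ≤ z := le_of_lt hz
    have hh0 : (0 : ℝ) ≤ h := le_of_lt hh
    have key : ∀ w : ℝ, 0 ≤ w → ψ (w + ∑ i, s i) =
        C.measure.real ({x | x 0 ≤ generatorPoint ψ w} ∩
          ⋂ i, {x | x (Fin.succ i) ≤ generatorPoint ψ (s i)}) := fun w hw => by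
      have := hC.cdf_generatorPoint (Fin.cons w s) (Fin.cases hw hs)
      rw [Fin.sum_univ_succ] at this
      simp only [Fin.cons_zero, Fin.cons_succ] at this
      rw [← this, cdf]
      congr 1
      ext x
      simp [Pi.le_def, Fin.forall_fin_succ]
    rw [key z hz0, show z + ∑ i, s i + h = z + h + ∑ i, s i by ring, key (z + h) (by positivity),
      ← measureReal_sdiff]
    · congr 1
      ext x
      simp only [Set.mem_sdiff, mem_inter_iff]
      tauto
    · refine inter_subset_inter_left _ fun x hx =>
        le_trans (show x 0 ≤ generatorPoint ψ (z + h) from hx)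
          (show generatorPoint ψ (z + h) ≤ generatorPoint ψ z from ?_)
      rw [← Subtype.coe_le_coe, hψ.coe_generatorPoint hz0, hψ.coe_generatorPoint (by positivity)]
      exact hψ.antitoneOn hz0 (show 0 ≤ z + h by positivity) (by linarith)
    · exact (hm _ _).inter (MeasurableSet.iInter fun i => hm _ _)

end Copula

end Generator

/-! ### Signed derivatives as densities, and the substitution `x = ψ(z)`. -/

section TailDensity

namespace IsArchimedeanGenerator

variable {ψ : ℝ → ℝ} {k : ℕ}

theorem convexOn_negLeftDerivIter (h : IsArchimedeanGenerator ψ)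
    (hm : IsMultiplyMonotone (k + 1) ψ) {m : ℕ} (hmk : m < k) :
    ConvexOn ℝ (Ioi 0) (negLeftDerivIter ψ m) := by
  obtain ⟨j, rfl⟩ := Nat.exists_eq_add_of_lt hmk
  have := IsMultiplyMonotone.negLeftDerivIter (h.continuousOn.mono Ioi_subset_Ici_self) m j
    (by rwa [show j + 2 + m = m + j + 1 + 1 by ring])
  exact this.1.convexOn this.2.1

theorem antitoneOn_negLeftDerivIter (h : IsArchimedeanGenerator ψ)
    (hm : IsMultiplyMonotone (k + 1) ψ) {m : ℕ} (hmk : m ≤ k) :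
    AntitoneOn (negLeftDerivIter ψ m) (Ioi 0) := by
  cases m with
  | zero => exact h.antitoneOn.mono Ioi_subset_Ici_self
  | succ m => exact (h.convexOn_negLeftDerivIter hm hmk).monotoneOn_leftDeriv_Ioi.neg

theorem negLeftDerivIter_nonneg (h : IsArchimedeanGenerator ψ)
    (hm : IsMultiplyMonotone (k + 1) ψ) {m : ℕ} (hmk : m ≤ k) {z : ℝ} (hz : 0 < z) :
    0 ≤ negLeftDerivIter ψ m z := by
  cases m with
  | zero => exact h.nonneg hz.le
  | succ m =>
    exact neg_nonneg.2 ((h.convexOn_negLeftDerivIter hm hmk).leftDeriv_nonpos_of_antitoneOn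
      (h.antitoneOn_negLeftDerivIter hm (Nat.le_of_succ_le hmk)) hz)

theorem tendsto_negLeftDerivIter_atTop (h : IsArchimedeanGenerator ψ)
    (hm : IsMultiplyMonotone (k + 1) ψ) {m : ℕ} (hmk : m ≤ k) :
    Tendsto (negLeftDerivIter ψ m) atTop (𝓝 0) := by
  induction m with
  | zero => exact h.tendsto_atTop
  | succ m ih =>
    have := ((h.convexOn_negLeftDerivIter hm hmk).tendsto_leftDeriv_atTop
      (h.antitoneOn_negLeftDerivIter hm (Nat.le_of_succ_le hmk)) (ih (Nat.le_of_succ_le hmk))).neg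
    rwa [neg_zero] at this

theorem negLeftDerivIter_eq_zero (h : IsArchimedeanGenerator ψ)
    (hm : IsMultiplyMonotone (k + 1) ψ) {z : ℝ} (hz : 0 ≤ z) (hz0 : ψ z = 0) {m : ℕ} (hmk : m ≤ k)
    {w : ℝ} (hw : z < w) : negLeftDerivIter ψ m w = 0 := by
  induction m generalizing w with
  | zero =>
    exact le_antisymm ((h.antitoneOn hz (hz.trans hw.le) hw.le).trans hz0.le)
      (h.nonneg (hz.trans hw.le))
  | succ m ih =>
    obtain ⟨v, hzv, hvw⟩ := exists_between hw
    have h1 := (h.convexOn_negLeftDerivIter hm hmk).slope_le_leftDeriv_Ioi (hz.trans_lt hzv) hvw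
    rw [slope_def_field, ih (Nat.le_of_succ_le hmk) hw, ih (Nat.le_of_succ_le hmk) hzv] at h1
    have h2 := h.negLeftDerivIter_nonneg hm hmk (hz.trans_lt hw)
    simp only [negLeftDerivIter] at h2 ⊢
    simp only [sub_self, zero_div] at h1
    linarith

end IsArchimedeanGenerator

/-- The `m`-th iterated negated left-hand derivative of `ψ` on `(0,∞)`, extended to an antitone
`[0,∞]`-valued function on the line. -/
noncomputable def tailDensity (ψ : ℝ → ℝ) (m : ℕ) (z : ℝ) : ℝ≥0∞ :=
  if 0 < z then ENNReal.ofReal (negLeftDerivIter ψ m z) else if m = 0 then 1 else ∞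

theorem tailDensity_of_pos (ψ : ℝ → ℝ) (m : ℕ) {z : ℝ} (hz : 0 < z) :
    tailDensity ψ m z = ENNReal.ofReal (negLeftDerivIter ψ m z) := if_pos hz

namespace IsArchimedeanGenerator

variable {ψ : ℝ → ℝ} {k : ℕ}

theorem tailDensity_zero (h : IsArchimedeanGenerator ψ) {z : ℝ} (hz : 0 ≤ z) :
    tailDensity ψ 0 z = ENNReal.ofReal (ψ z) := by
  rcases hz.eq_or_lt with rfl | hz
  · simp [tailDensity, h.map_zero]
  · exact tailDensity_of_pos ψ 0 hz

theorem antitone_tailDensity (h : IsArchimedeanGenerator ψ)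
    (hm : IsMultiplyMonotone (k + 1) ψ) {m : ℕ} (hmk : m ≤ k) : Antitone (tailDensity ψ m) := by
  intro x y hxy
  by_cases hx : 0 < x
  · rw [tailDensity_of_pos ψ m hx, tailDensity_of_pos ψ m (hx.trans_le hxy)]
    exact ENNReal.ofReal_le_ofReal
      (h.antitoneOn_negLeftDerivIter hm hmk hx (hx.trans_le hxy) hxy)
  · by_cases hm0 : m = 0
    · subst hm0
      by_cases hy : 0 < y
      · rw [tailDensity_of_pos ψ 0 hy, tailDensity, if_neg hx, if_pos rfl]
        exact ENNReal.ofReal_le_one.2 (h.le_one hy.le)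
      · simp [tailDensity, hx, hy]
    · simp [tailDensity, hx, hm0]

theorem measurable_tailDensity (h : IsArchimedeanGenerator ψ)
    (hm : IsMultiplyMonotone (k + 1) ψ) {m : ℕ} (hmk : m ≤ k) : Measurable (tailDensity ψ m) :=
  (h.antitone_tailDensity hm hmk).measurable

/-- Integration lowers the order by one. For `m > 0` the value at `0` is set to `∞`, while the
right-hand limit there may be finite, hence the alternative `ham`. -/
theorem lintegral_tailDensity (h : IsArchimedeanGenerator ψ)
    (hm : IsMultiplyMonotone (k + 1) ψ) {m : ℕ} (hmk : m < k) {a : ℝ} (ha : 0 ≤ a)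
    (ham : 0 < a ∨ m = 0) : ∫⁻ s in Ioi a, tailDensity ψ (m + 1) s = tailDensity ψ m a := by
  have hcv := h.convexOn_negLeftDerivIter hm hmk
  have h1 : ∫⁻ s in Ioi a, tailDensity ψ (m + 1) s =
      ∫⁻ s in Ioi a, ENNReal.ofReal (-leftDeriv (negLeftDerivIter ψ m) s) :=
    setLIntegral_congr_fun measurableSet_Ioi fun s hs =>
      tailDensity_of_pos ψ (m + 1) (ha.trans_lt hs)
  have hc : ContinuousWithinAt (negLeftDerivIter ψ m) (Ioi a) a := by
    rcases ham with ha' | rfl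
    · exact ((hcv.continuousOn isOpen_Ioi).continuousAt (Ioi_mem_nhds ha')).continuousWithinAt
    · exact (h.continuousOn a ha).mono fun x hx => ha.trans (le_of_lt hx)
  rw [h1, hcv.lintegral_neg_leftDeriv (h.antitoneOn_negLeftDerivIter hm hmk.le)
    (h.tendsto_negLeftDerivIter_atTop hm hmk.le) ha hc]
  rcases ham with ha' | rfl
  · exact (tailDensity_of_pos ψ m ha').symm
  · exact (h.tailDensity_zero ha).symm

theorem lintegral_tailDensity_add (h : IsArchimedeanGenerator ψ)
    (hm : IsMultiplyMonotone (k + 1) ψ) {m : ℕ} (hmk : m < k) {a b : ℝ} (ha : 0 ≤ a + b)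
    (ham : 0 < a + b ∨ m = 0) :
    ∫⁻ s in Ioi b, tailDensity ψ (m + 1) (a + s) = tailDensity ψ m (a + b) := by
  rw [← h.lintegral_tailDensity hm hmk ha ham]
  have := (measurePreserving_add_left (volume : Measure ℝ) a).setLIntegral_comp_preimage
    (measurableSet_Ioi (a := a + b)) (h.measurable_tailDensity hm (Nat.succ_le_of_lt hmk))
  rw [← this]
  congr 2
  ext s; simp

theorem tailDensity_eq_zero (h : IsArchimedeanGenerator ψ)
    (hm : IsMultiplyMonotone (k + 1) ψ) {z : ℝ} (hz : 0 ≤ z) (hz0 : ψ z = 0) {m : ℕ} (hmk : m ≤ k)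
    {w : ℝ} (hw : z < w) : tailDensity ψ m w = 0 := by
  rw [tailDensity_of_pos ψ m (hz.trans_lt hw), h.negLeftDerivIter_eq_zero hm hz hz0 hmk hw,
    ENNReal.ofReal_zero]

/-- Being antitone, `-ψ'` would vanish on `(z, ∞)` if it vanished at `z`, but its integral there is
`ψ z > 0`. -/
theorem tailDensity_one_ne_zero (h : IsArchimedeanGenerator ψ)
    (hm : IsMultiplyMonotone (k + 1) ψ) (hk : 0 < k) {z : ℝ} (hz : 0 ≤ z) (hz0 : 0 < ψ z) :
    tailDensity ψ 1 z ≠ 0 := by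
  intro h0
  have h1 := h.lintegral_tailDensity hm hk hz (Or.inr rfl)
  have h2 : ∫⁻ s in Ioi z, tailDensity ψ (0 + 1) s = ∫⁻ s in Ioi z, 0 :=
    setLIntegral_congr_fun measurableSet_Ioi fun s hs =>
      le_antisymm ((h.antitone_tailDensity hm hk (le_of_lt hs)).trans h0.le) zero_le
  rw [h2, lintegral_zero, h.tailDensity_zero hz] at h1
  exact (ENNReal.ofReal_pos.2 hz0).ne h1

theorem ae_eq_Ioi_of_pseudoInverse (h : IsArchimedeanGenerator ψ) {y : ℝ} (hy : y ∈ Icc (0 : ℝ) 1)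
    (ht : pseudoInverse ψ y ≠ ∞) :
    ({z | ψ z ≤ y} ∩ Ioi 0 : Set ℝ) =ᵐ[volume] Ioi (pseudoInverse ψ y).toReal := by
  have hS : ∀ z : ℝ, 0 < z → (ψ z ≤ y ↔ (pseudoInverse ψ y).toReal ≤ z) := fun z hz => by
    rw [← ENNReal.le_ofReal_iff_toReal_le ht hz.le, h.pseudoInverse_le_iff hy,
      extendTop_ofReal ψ hz.le]
  have h1 : Ioi (pseudoInverse ψ y).toReal ⊆ {z | ψ z ≤ y} ∩ Ioi 0 := fun z hz => by
    have hz0 : 0 < z := ENNReal.toReal_nonneg.trans_lt hz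
    exact ⟨(hS z hz0).2 (le_of_lt hz), hz0⟩
  have h2 : ({z | ψ z ≤ y} ∩ Ioi 0 : Set ℝ) ⊆ Ici (pseudoInverse ψ y).toReal :=
    fun z hz => (hS z hz.2).1 hz.1
  exact (h2.eventuallyLE.trans (Ioi_ae_eq_Ici (μ := volume)).symm.le).antisymm h1.eventuallyLE

theorem preimage_generatorPoint_Iic (h : IsArchimedeanGenerator ψ) (y : I) :
    generatorPoint ψ ⁻¹' Iic y ∩ Ioi 0 = {z | ψ z ≤ y} ∩ Ioi 0 := by
  ext z
  simp only [mem_inter_iff, mem_preimage, mem_Iic, mem_ofPred_eq, mem_Ioi, and_congr_left_iff]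
  intro hz
  rw [← Subtype.coe_le_coe, h.coe_generatorPoint hz.le]

/-- The law of `ψ(Z)`, where `Z` has density `-ψ'`, is uniform. -/
theorem map_generatorPoint (h : IsArchimedeanGenerator ψ)
    (hm : IsMultiplyMonotone (k + 1) ψ) (hk : 0 < k) :
    ((volume.restrict (Ioi 0)).withDensity (tailDensity ψ 1)).map (generatorPoint ψ) =
      (volume : Measure I) := by
  symm
  refine Measure.ext_of_Iic _ _ fun y => ?_
  rw [Measure.map_apply h.continuous_generatorPoint.measurable measurableSet_Iic,
    withDensity_apply _ (h.continuous_generatorPoint.measurable measurableSet_Iic),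
    Measure.restrict_restrict (h.continuous_generatorPoint.measurable measurableSet_Iic),
    h.preimage_generatorPoint_Iic, unitInterval.volume_Iic]
  by_cases ht : pseudoInverse ψ y = ∞
  · have hy0 := h.extendTop_pseudoInverse y.2
    rw [ht, extendTop_top] at hy0
    have : ({z | ψ z ≤ y} ∩ Ioi 0 : Set ℝ) = ∅ := by
      ext z
      simp only [mem_inter_iff, mem_ofPred_eq, mem_Ioi, mem_empty_iff_false, iff_false, not_and]
      intro hz hz0
      rw [← extendTop_ofReal ψ hz0.le, ← h.pseudoInverse_le_iff y.2, ht] at hz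
      exact ENNReal.ofReal_ne_top (top_le_iff.1 hz)
    rw [this, ← hy0]; simp
  · rw [setLIntegral_congr (h.ae_eq_Ioi_of_pseudoInverse y.2 ht),
      ← zero_add 1, h.lintegral_tailDensity hm hk ENNReal.toReal_nonneg (Or.inr rfl),
      h.tailDensity_zero ENNReal.toReal_nonneg, ← extendTop_of_ne_top ψ ht,
      h.extendTop_pseudoInverse y.2]

theorem measurable_toReal_pseudoInverse (h : IsArchimedeanGenerator ψ) :
    Measurable fun x : I => (pseudoInverse ψ x).toReal := by
  have : Antitone fun x : I => pseudoInverse ψ x := fun x y hxy =>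
    h.strictAntiOn_pseudoInverse.antitoneOn x.2 y.2 hxy
  exact this.measurable.ennreal_toReal

/-- Change of variables `x = ψ(z)` on the unit interval. -/
theorem setLIntegral_comp_pseudoInverse (h : IsArchimedeanGenerator ψ)
    (hm : IsMultiplyMonotone (k + 1) ψ) (hk : 0 < k) {g : ℝ → ℝ≥0∞} (hg : Measurable g)
    (hg0 : ∀ z, 0 ≤ z → ψ z = 0 → ∀ w, z < w → g w = 0) {y : I} (hy : 0 < y) :
    ∫⁻ x in Iic y, (tailDensity ψ 1 (pseudoInverse ψ x).toReal)⁻¹ *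
      g (pseudoInverse ψ x).toReal = ∫⁻ z in Ioi (pseudoInverse ψ y).toReal, g z := by
  have ht1 : Measurable (tailDensity ψ 1) := h.measurable_tailDensity hm hk
  have hφ := h.measurable_toReal_pseudoInverse
  have hp := h.continuous_generatorPoint.measurable
  have hF : Measurable fun x : I => (tailDensity ψ 1 (pseudoInverse ψ x).toReal)⁻¹ *
      g (pseudoInverse ψ x).toReal := (ht1.comp hφ).inv.mul (hg.comp hφ)
  have hFp : Measurable fun z : ℝ =>
      (tailDensity ψ 1 (pseudoInverse ψ (generatorPoint ψ z)).toReal)⁻¹ *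
        g (pseudoInverse ψ (generatorPoint ψ z)).toReal := hF.comp hp
  have hy' : (y : ℝ) ∈ Ioc (0 : ℝ) 1 := ⟨hy, y.2.2⟩
  rw [← h.map_generatorPoint hm hk, setLIntegral_map measurableSet_Iic hF hp,
    setLIntegral_withDensity_eq_setLIntegral_mul _ ht1 hFp (hp measurableSet_Iic),
    Measure.restrict_restrict (hp measurableSet_Iic), h.preimage_generatorPoint_Iic,
    setLIntegral_congr (h.ae_eq_Ioi_of_pseudoInverse y.2 (h.pseudoInverse_ne_top hy'))]
  refine setLIntegral_congr_fun_ae measurableSet_Ioi ?_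
  -- The density `-ψ'` cancels its inverse only where `ψ > 0`. Beyond the zero of `ψ` both it and
  -- `g` vanish; the zero itself is one discarded point.
  have hne : ∀ᵐ z : ℝ, z ≠ (pseudoInverse ψ 0).toReal := by simp [ae_iff]
  filter_upwards [hne] with z hz hzy
  have hz0 : 0 < z := ENNReal.toReal_nonneg.trans_lt hzy
  simp only [Pi.mul_apply, h.coe_generatorPoint hz0.le]
  rcases (h.nonneg hz0.le).eq_or_lt with hψ | hψ
  · have h1 := (h.pseudoInverse_le_iff (y := 0) ⟨le_rfl, zero_le_one⟩ (ENNReal.ofReal z)).2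
      (by rw [extendTop_ofReal ψ hz0.le, hψ])
    have htop : pseudoInverse ψ 0 ≠ ∞ := ne_top_of_le_ne_top ENNReal.ofReal_ne_top h1
    have h2 := h.extendTop_pseudoInverse (y := 0) ⟨le_rfl, zero_le_one⟩
    rw [extendTop_of_ne_top ψ htop] at h2
    have h3 : (pseudoInverse ψ 0).toReal < z :=
      lt_of_le_of_ne ((ENNReal.le_ofReal_iff_toReal_le htop hz0.le).1 h1) hz.symm
    rw [hg0 _ ENNReal.toReal_nonneg h2 z h3,
      h.tailDensity_eq_zero hm ENNReal.toReal_nonneg h2 hk h3, zero_mul]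
  · rw [h.toReal_pseudoInverse_map hz0.le hψ, ← mul_assoc, ENNReal.mul_inv_cancel, one_mul]
    · exact h.tailDensity_one_ne_zero hm hk hz0.le hψ
    · rw [tailDensity_of_pos ψ 1 hz0]; exact ENNReal.ofReal_ne_top

end IsArchimedeanGenerator

end TailDensity

/-! ### Explicit density of the first coordinates and of the kernel. -/

section ArchimedeanDensity

theorem piFinSuccAbove_zero_apply {n : ℕ} (x : Fin (n + 1) → I) :
    MeasurableEquiv.piFinSuccAbove (fun _ : Fin (n + 1) => I) 0 x = (x 0, fun i => x i.succ) := rfl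

/-- The candidate for the density of `A ↦ μ_C (A × [0,y])`, where `w = φ(y)`. -/
noncomputable def archimedeanDensity (ψ : ℝ → ℝ) (m n : ℕ) (w : ℝ) (x : Fin n → I) : ℝ≥0∞ :=
  (∏ i, (tailDensity ψ 1 (pseudoInverse ψ (x i)).toReal)⁻¹) *
    tailDensity ψ (m + n) (w + ∑ i, (pseudoInverse ψ (x i)).toReal)

namespace IsArchimedeanGenerator

variable {ψ : ℝ → ℝ} {k : ℕ}

theorem measurable_archimedeanDensity (h : IsArchimedeanGenerator ψ)
    (hm : IsMultiplyMonotone (k + 1) ψ) (hk : 0 < k) {m n : ℕ} (hmn : m + n ≤ k) {α : Type*}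
    [MeasurableSpace α] {f : α → ℝ} {g : α → Fin n → I} (hf : Measurable f) (hg : Measurable g) :
    Measurable fun p => archimedeanDensity ψ m n (f p) (g p) := by
  have h1 : Measurable (tailDensity ψ 1) := h.measurable_tailDensity hm hk
  have h2 := h.measurable_tailDensity hm hmn
  have h3 : ∀ i, Measurable fun p : α => (pseudoInverse ψ (g p i)).toReal :=
    fun i => h.measurable_toReal_pseudoInverse.comp ((measurable_pi_apply i).comp hg)
  refine (Finset.measurable_prod _ fun i _ => (h1.comp (h3 i)).inv).mul (h2.comp ?_)
  exact hf.add (Finset.measurable_sum _ fun i _ => h3 i)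

/-- Induction on the number of coordinates: `φ` of the first one is moved into the shift `a`, which
raises `m` by one; the others are integrated by induction, and the first is then integrated through
`x = ψ(z)`, which lowers `m` again. -/
theorem setLIntegral_archimedeanDensity (h : IsArchimedeanGenerator ψ)
    (hm : IsMultiplyMonotone (k + 1) ψ) (n m : ℕ) (hmn : m + n ≤ k) {a : ℝ} (ha : 0 ≤ a)
    (ham : 0 < a ∨ m = 0) (x₀ : Fin n → I) (hx₀ : ∀ i, 0 < x₀ i) :
    ∫⁻ x in Iic x₀, archimedeanDensity ψ m n a x =
      tailDensity ψ m (a + ∑ i, (pseudoInverse ψ (x₀ i)).toReal) := by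
  induction n generalizing m a with
  | zero =>
    have : Iic x₀ = univ := by ext x; simp [Subsingleton.elim x x₀]
    rw [this, setLIntegral_univ, volume_pi, Measure.pi_of_empty (x := x₀), lintegral_dirac]
    simp [archimedeanDensity]
  | succ n ih =>
    have hk : 0 < k := by omega
    have hφ := h.measurable_toReal_pseudoInverse
    set s₀ := ∑ i : Fin n, (pseudoInverse ψ (x₀ i.succ)).toReal with hs₀
    have hs₀0 : 0 ≤ s₀ := Finset.sum_nonneg fun i _ => ENNReal.toReal_nonneg
    have hmp := volume_preserving_piFinSuccAbove (fun _ : Fin (n + 1) => I) 0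
    have hpre : Iic x₀ = MeasurableEquiv.piFinSuccAbove (fun _ : Fin (n + 1) => I) 0 ⁻¹'
        (Iic (x₀ 0) ×ˢ Iic fun i => x₀ i.succ) := by
      ext x
      rw [mem_preimage, piFinSuccAbove_zero_apply]
      simp [Pi.le_def, Fin.forall_fin_succ]
    let F : I × (Fin n → I) → ℝ≥0∞ := fun p =>
      (tailDensity ψ 1 (pseudoInverse ψ p.1).toReal)⁻¹ *
        archimedeanDensity ψ (m + 1) n (a + (pseudoInverse ψ p.1).toReal) p.2
    have hmn' : m + 1 + n ≤ k := by omega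
    have ht1 : Measurable (tailDensity ψ 1) := h.measurable_tailDensity hm hk
    have hF1 : Measurable fun p : I × (Fin n → I) =>
        (tailDensity ψ 1 (pseudoInverse ψ p.1).toReal)⁻¹ :=
      (ht1.comp (hφ.comp measurable_fst)).inv
    have hF : Measurable F := hF1.mul (h.measurable_archimedeanDensity hm hk hmn'
      (measurable_const.add (hφ.comp measurable_fst)) measurable_snd)
    have hFe : ∀ x, archimedeanDensity ψ m (n + 1) a x =
        F (MeasurableEquiv.piFinSuccAbove (fun _ : Fin (n + 1) => I) 0 x) := fun x => by
      simp only [archimedeanDensity, F, piFinSuccAbove_zero_apply, Fin.prod_univ_succ,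
        Fin.sum_univ_succ, mul_assoc, add_assoc, add_comm 1 n]
    simp only [hFe]
    rw [hpre, hmp.setLIntegral_comp_preimage (measurableSet_Iic.prod measurableSet_Iic) hF,
      Measure.volume_eq_prod, setLIntegral_prod _ hF.aemeasurable]
    -- The induction hypothesis at order `m + 1` needs a positive shift. This excludes `x = 1`,
    -- where `φ` is zero, and `x = 0`, where `φ` may be `∞` and `toReal` would return `0`.
    have hinner : ∀ᵐ x : I, x ∈ Iic (x₀ 0) → ∫⁻ y in Iic fun i => x₀ i.succ, F (x, y) =
        (tailDensity ψ 1 (pseudoInverse ψ x).toReal)⁻¹ *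
          tailDensity ψ (m + 1) (a + s₀ + (pseudoInverse ψ x).toReal) := by
      have hne1 : ∀ᵐ x : I, x ≠ 1 := by
        simp [ae_iff]
      have hne0 : ∀ᵐ x : I, x ≠ 0 := by
        simp [ae_iff]
      filter_upwards [hne1, hne0] with x hx1 hx0 _
      have hx0' : (0 : ℝ) < x := lt_of_le_of_ne x.2.1 fun he => hx0 (Subtype.ext he.symm)
      have hx1' : (x : ℝ) < 1 := lt_of_le_of_ne x.2.2 fun he => hx1 (Subtype.ext he)
      have hpos : 0 < (pseudoInverse ψ x).toReal :=
        ENNReal.toReal_pos (h.pseudoInverse_pos ⟨hx0'.le, hx1'⟩).ne'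
          (h.pseudoInverse_ne_top ⟨hx0', hx1'.le⟩)
      simp only [F]
      have hJ : Measurable fun y : Fin n → I =>
          archimedeanDensity ψ (m + 1) n (a + (pseudoInverse ψ x).toReal) y :=
        h.measurable_archimedeanDensity hm hk hmn' measurable_const measurable_id
      rw [lintegral_const_mul _ hJ, ih (m + 1) (by omega) (add_nonneg ha hpos.le)
        (Or.inl (add_pos_of_nonneg_of_pos ha hpos))
          (fun i => x₀ i.succ) fun i => hx₀ _]
      congr 2
      rw [← hs₀]; ring
    rw [setLIntegral_congr_fun_ae measurableSet_Iic hinner,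
      h.setLIntegral_comp_pseudoInverse hm hk
        (g := fun z => tailDensity ψ (m + 1) (a + s₀ + z))
        ((h.measurable_tailDensity hm (by omega)).comp (measurable_const_add _))
        (fun z hz hz0 w hw => h.tailDensity_eq_zero hm hz hz0 (by omega) (by linarith)) (hx₀ 0),
      h.lintegral_tailDensity_add hm (by omega)
        (add_nonneg (add_nonneg ha hs₀0) ENNReal.toReal_nonneg)
        (ham.imp_left fun ha' => by positivity), Fin.sum_univ_succ, ← hs₀]
    congr 1; ring

/-- `φ` is injective on `(0,1]`, so besides `0` the level set has at most one point. -/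
theorem volume_toReal_pseudoInverse_eq (h : IsArchimedeanGenerator ψ) (c : ℝ) :
    volume {x : I | (pseudoInverse ψ x).toReal = c} = 0 := by
  have hsub : {x : I | (pseudoInverse ψ x).toReal = c} ⊆ {0} ∪ {generatorPoint ψ c} := by
    intro x hx
    rcases x.2.1.eq_or_lt with h0 | h0
    · exact Or.inl (Subtype.ext h0.symm)
    · refine Or.inr (Subtype.ext ?_)
      have hx' : (pseudoInverse ψ x).toReal = c := hx
      rw [h.coe_generatorPoint (hx' ▸ ENNReal.toReal_nonneg), ← hx',
        h.map_toReal_pseudoInverse ⟨h0, x.2.2⟩]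
  have hpt : ∀ x : I, volume ({x} : Set I) = 0 := fun x => by
    simp
  exact measure_mono_null hsub (measure_union_null (hpt _) (hpt _))

/-- By Fubini: with the other coordinates fixed, the section in the first is a level set of `φ`. -/
theorem volume_sum_pseudoInverse_eq (h : IsArchimedeanGenerator ψ) (n : ℕ) (c : ℝ) :
    volume {x : Fin (n + 1) → I | ∑ i, (pseudoInverse ψ (x i)).toReal = c} = 0 := by
  have hmp := volume_preserving_piFinSuccAbove (fun _ : Fin (n + 1) => I) 0
  let S : Set (I × (Fin n → I)) :=
    {p | (pseudoInverse ψ p.1).toReal + ∑ i, (pseudoInverse ψ (p.2 i)).toReal = c}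
  have hφ := h.measurable_toReal_pseudoInverse
  have hS : MeasurableSet S := measurableSet_eq_fun
    ((hφ.comp measurable_fst).add (Finset.measurable_sum _ fun i _ =>
      hφ.comp ((measurable_pi_apply i).comp measurable_snd))) measurable_const
  have hpre : {x : Fin (n + 1) → I | ∑ i, (pseudoInverse ψ (x i)).toReal = c} =
      MeasurableEquiv.piFinSuccAbove (fun _ : Fin (n + 1) => I) 0 ⁻¹' S := by
    ext x
    rw [mem_preimage, piFinSuccAbove_zero_apply]
    simp [S, Fin.sum_univ_succ]
  rw [hpre, hmp.measure_preimage hS.nullMeasurableSet, Measure.volume_eq_prod,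
    Measure.prod_apply_symm hS]
  refine (lintegral_congr fun y => ?_).trans lintegral_zero
  have := h.volume_toReal_pseudoInverse_eq (c - ∑ i, (pseudoInverse ψ (y i)).toReal)
  convert! this using 2
  ext x
  simp [S, eq_sub_iff_add_eq]

/-- Applied with `s` the set of jumps of the highest left-hand derivative. -/
theorem ae_sum_pseudoInverse_notMem (h : IsArchimedeanGenerator ψ) (hk : 0 < k) {s : Set ℝ}
    (hs : s.Countable) (w : ℝ) :
    ∀ᵐ x : Fin k → I, w + ∑ i, (pseudoInverse ψ (x i)).toReal ∉ s := by
  obtain ⟨n, rfl⟩ := Nat.exists_eq_succ_of_ne_zero hk.ne'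
  have : ∀ᵐ x : Fin (n + 1) → I, ∀ c ∈ s, w + ∑ i, (pseudoInverse ψ (x i)).toReal ≠ c := by
    rw [ae_ball_iff hs]
    intro c _
    rw [ae_iff]
    have := h.volume_sum_pseudoInverse_eq n (c - w)
    convert! this using 2
    ext x
    simp [eq_sub_iff_add_eq, add_comm]
  filter_upwards [this] with x hx hmem using hx _ hmem rfl

end IsArchimedeanGenerator

theorem volume_Iic_pi_eq_zero {n : ℕ} {x₀ : Fin n → I} {i : Fin n} (hi : x₀ i = 0) :
    volume (Iic x₀) = 0 := by
  rw [← pi_univ_Iic, volume_pi_pi]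
  exact Finset.prod_eq_zero (Finset.mem_univ i) (by simp [hi])

/-- Finite measures on the unit cube are determined by their distribution functions. -/
theorem measure_cube_ext_of_Iic {n : ℕ} {μ ν : Measure (Fin n → I)} [IsFiniteMeasure μ]
    (h : ∀ x, μ (Iic x) = ν (Iic x)) : μ = ν := by
  have hgen : MeasurableSpace.generateFrom
      (pi univ '' pi univ fun _ : Fin n => range (Iic (α := I)))
      = MeasurableSpace.pi := by
    refine generateFrom_eq_pi (fun _ => (borel_eq_generateFrom_Iic I).symm.trans
      BorelSpace.measurable_eq.symm) fun _ => ⟨fun _ => univ, fun _ => ⟨1, ?_⟩, iUnion_const _⟩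
    ext x; simp [unitInterval.le_one']
  refine ext_of_generate_finite _ hgen.symm (IsPiSystem.pi fun _ => isPiSystem_Iic) ?_ ?_
  · rintro _ ⟨t, ht, rfl⟩
    choose y hy using fun i => ht i (mem_univ i)
    have : univ.pi t = Iic y := by
      rw [← pi_univ_Iic]; exact congrArg _ (funext fun i => (hy i).symm)
    rw [this, h]
  · have : (univ : Set (Fin n → I)) = Iic 1 := by ext x; simp [Pi.le_def, unitInterval.le_one']
    rw [this, h]

namespace Copula

variable {k : ℕ} {C : Copula (k + 1)} {ψ : ℝ → ℝ}

theorem measurable_castSucc : Measurable fun (x : Fin (k + 1) → I) (i : Fin k) => x i.castSucc :=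
  measurable_pi_lambda _ fun i => measurable_pi_apply i.castSucc

theorem measurable_split : Measurable fun x : Fin (k + 1) → I =>
    ((fun i : Fin k => x i.castSucc), x (Fin.last k)) :=
  measurable_castSucc.prodMk (measurable_pi_apply _)

instance (C : Copula (k + 1)) : IsProbabilityMeasure C.initMarginal :=
  Measure.isProbabilityMeasure_map measurable_castSucc.aemeasurable

theorem splitMeasure_fst (C : Copula (k + 1)) : C.splitMeasure.fst = C.initMarginal := by
  rw [Measure.fst, splitMeasure, Measure.map_map measurable_fst measurable_split]
  rfl

theorem splitMeasure_prod_Iic (C : Copula (k + 1)) (x₀ : Fin k → I) (y : I) :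
    C.splitMeasure (Iic x₀ ×ˢ Iic y) = C.measure (Iic (Fin.snoc x₀ y : Fin (k + 1) → I)) := by
  rw [splitMeasure, Measure.map_apply measurable_split (measurableSet_Iic.prod measurableSet_Iic)]
  congr 1
  ext x
  simp [Pi.le_def, Fin.forall_fin_succ']

theorem measure_setOf_eq_zero {d : ℕ} (C : Copula d) (i : Fin d) (y : I) :
    C.measure {x | x i = y} = 0 := by
  have := congrArg (fun μ => μ (Icc y y)) (C.map_eval i)
  simp only [unitInterval.volume_Icc, Measure.map_apply (measurable_pi_apply i) measurableSet_Icc,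
    sub_self, ENNReal.ofReal_zero] at this
  rw [← this]; congr 1; ext x; simp

theorem measure_Iic_eq_zero {d : ℕ} (C : Copula d) {x : Fin d → I} {i : Fin d} (hi : x i = 0) :
    C.measure (Iic x) = 0 :=
  measure_mono_null (fun z (hz : z ≤ x) => le_antisymm ((hz i).trans hi.le) unitInterval.nonneg')
    (C.measure_setOf_eq_zero i 0)

theorem IsArchimedeanWith.setLIntegral_archimedeanDensity (hC : C.IsArchimedeanWith ψ)
    (x₀ : Fin k → I) {y : I} (hy : 0 < y) :
    ∫⁻ x in Iic x₀, archimedeanDensity ψ 0 k (pseudoInverse ψ y).toReal x =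
      C.splitMeasure (Iic x₀ ×ˢ Iic y) := by
  have h := hC.generator
  rw [splitMeasure_prod_Iic]
  by_cases hx₀ : ∀ i, 0 < x₀ i
  · have hne : ∀ x : I, 0 < x → pseudoInverse ψ x ≠ ∞ := fun x hx =>
      h.pseudoInverse_ne_top ⟨hx, x.2.2⟩
    rw [h.setLIntegral_archimedeanDensity hC.isMultiplyMonotone k 0 (by simp)
      ENNReal.toReal_nonneg (Or.inr rfl) x₀ hx₀, h.tailDensity_zero
      (add_nonneg ENNReal.toReal_nonneg (Finset.sum_nonneg fun i _ => ENNReal.toReal_nonneg)),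
      ← ofReal_measureReal]
    have hcdf := hC.cdf_eq (Fin.snoc x₀ y)
    rw [cdf, Fin.sum_univ_castSucc] at hcdf
    simp only [Fin.snoc_castSucc, Fin.snoc_last] at hcdf
    have hs : ∑ i, pseudoInverse ψ (x₀ i) ≠ ∞ :=
      ENNReal.sum_ne_top.2 fun i _ => hne _ (hx₀ i)
    rw [hcdf, extendTop_of_ne_top ψ (ENNReal.add_ne_top.2 ⟨hs, hne y hy⟩),
      ENNReal.toReal_add hs (hne y hy), ENNReal.toReal_sum fun i _ => hne _ (hx₀ i), add_comm]
  -- With a zero coordinate `toReal` may lose `φ = ∞`, but the box is null for both measures.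
  · push Not at hx₀
    obtain ⟨i, hi⟩ := hx₀
    have hi0 : x₀ i = 0 := le_antisymm hi unitInterval.nonneg'
    rw [setLIntegral_measure_zero _ _ (volume_Iic_pi_eq_zero hi0),
      C.measure_Iic_eq_zero (i := i.castSucc) (by simpa using hi0)]

theorem IsArchimedeanWith.measurable_archimedeanDensity (hC : C.IsArchimedeanWith ψ) (hk : 0 < k)
    (w : ℝ) : Measurable (archimedeanDensity ψ 0 k w) :=
  hC.generator.measurable_archimedeanDensity hC.isMultiplyMonotone hk (zero_add k).le
    measurable_const measurable_id

/-- The first `k` coordinates have a density. -/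
theorem IsArchimedeanWith.initMarginal_eq (hC : C.IsArchimedeanWith ψ) :
    C.initMarginal = volume.withDensity (archimedeanDensity ψ 0 k 0) := by
  refine measure_cube_ext_of_Iic fun x => ?_
  have h1 := hC.setLIntegral_archimedeanDensity x (y := 1) zero_lt_one
  rw [show ((1 : I) : ℝ) = 1 from rfl, hC.generator.pseudoInverse_one, ENNReal.toReal_zero] at h1
  rw [withDensity_apply _ measurableSet_Iic, h1, ← splitMeasure_fst,
    Measure.fst_apply measurableSet_Iic]
  congr 1
  ext p
  simp [Prod.le_def, unitInterval.le_one']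

theorem IsArchimedeanWith.initDensity_ae_eq (hC : C.IsArchimedeanWith ψ) (hk : 0 < k) :
    C.initDensity =ᵐ[volume] archimedeanDensity ψ 0 k 0 := by
  rw [initDensity, hC.initMarginal_eq]
  exact Measure.rnDeriv_withDensity _ (hC.measurable_archimedeanDensity hk 0)

/-- Both sides are densities of `A ↦ μ_C(A × [0,y])`. The product form avoids dividing where the
density vanishes; `y > 0` keeps `φ(y)` finite. -/
theorem IsArchimedeanWith.kernel_mul_density_ae_eq (hC : C.IsArchimedeanWith ψ) (hk : 0 < k)
    {K : Kernel (Fin k → I) I} [IsMarkovKernel K] (hK : C.IsMarkovKernelOf K) {y : I}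
    (hy : 0 < y) :
    (fun x => archimedeanDensity ψ 0 k 0 x * K x (Iic y)) =ᵐ[volume]
      archimedeanDensity ψ 0 k (pseudoInverse ψ y).toReal := by
  have hKm : Measurable fun x => K x (Iic y) := K.measurable_coe measurableSet_Iic
  have hd := hC.measurable_archimedeanDensity hk
  have hK' : C.initMarginal ⊗ₘ K = C.splitMeasure := by
    rw [← splitMeasure_fst]; exact hK.disintegrate
  have hbox : ∀ x₀ : Fin k → I, (C.initMarginal.withDensity fun x => K x (Iic y)) (Iic x₀) =
      C.splitMeasure (Iic x₀ ×ˢ Iic y) := fun x₀ => by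
    rw [withDensity_apply _ measurableSet_Iic, ← hK',
      Measure.compProd_apply_prod measurableSet_Iic measurableSet_Iic]
  have hfin : IsFiniteMeasure (C.initMarginal.withDensity fun x => K x (Iic y)) :=
    isFiniteMeasure_withDensity (((lintegral_mono fun x => prob_le_one).trans_lt
      (by simp : ∫⁻ _, 1 ∂C.initMarginal < ∞)).ne)
  have heq : (C.initMarginal.withDensity fun x => K x (Iic y)) =
      volume.withDensity (archimedeanDensity ψ 0 k (pseudoInverse ψ y).toReal) :=
    measure_cube_ext_of_Iic fun x₀ => by
      rw [hbox, withDensity_apply _ measurableSet_Iic, hC.setLIntegral_archimedeanDensity x₀ hy]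
  have hmul : (C.initMarginal.withDensity fun x => K x (Iic y)) =
      volume.withDensity (archimedeanDensity ψ 0 k 0 * fun x => K x (Iic y)) := by
    rw [hC.initMarginal_eq, withDensity_mul _ (hd 0) hKm]
  refine (withDensity_eq_iff ((hd 0).mul hKm).aemeasurable (hd _).aemeasurable ?_).1
    (hmul.symm.trans heq)
  rw [← setLIntegral_univ, ← withDensity_apply _ MeasurableSet.univ, ← hmul]
  exact measure_ne_top _ _

end Copula

end ArchimedeanDensity

/-! ### Convergence of generators, pseudo-inverses and copulas. -/

section GeneratorConvergence

namespace IsArchimedeanGenerator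

variable {ψ : ℝ → ℝ} {ψs : ℕ → ℝ → ℝ}

theorem lt_of_lt_of_pos (h : IsArchimedeanGenerator ψ) {s t : ℝ} (hs : 0 ≤ s) (hst : s < t)
    (hp : 0 < ψ s) : ψ t < ψ s := by
  refine lt_of_le_of_ne (h.antitoneOn hs (hs.trans hst.le) hst.le) fun he => ?_
  have h1 := h.toReal_pseudoInverse_map hs hp
  have h2 := h.toReal_pseudoInverse_map (hs.trans hst.le) (he ▸ hp)
  rw [he, h1] at h2
  exact hst.ne h2

theorem le_toReal_pseudoInverse_iff (h : IsArchimedeanGenerator ψ) {y : ℝ}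
    (hy : y ∈ Ioc (0 : ℝ) 1) {z : ℝ} (hz : 0 ≤ z) :
    z ≤ (pseudoInverse ψ y).toReal ↔ y ≤ ψ z := by
  have h0 : 0 ≤ (pseudoInverse ψ y).toReal := ENNReal.toReal_nonneg
  have he := h.map_toReal_pseudoInverse hy
  constructor
  · intro hle
    rw [← he]; exact h.antitoneOn hz h0 hle
  · intro hle
    by_contra! hlt
    have := h.lt_of_lt_of_pos h0 hlt (he.symm ▸ hy.1)
    linarith

theorem tendsto_extendTop (hψ : ∀ z, 0 ≤ z → Tendsto (fun n => ψs n z) atTop (𝓝 (ψ z)))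
    (u : ℝ≥0∞) : Tendsto (fun n => extendTop (ψs n) u) atTop (𝓝 (extendTop ψ u)) := by
  by_cases hu : u = ∞
  · simp [hu, extendTop_top]
  · simp only [extendTop_of_ne_top _ hu]; exact hψ _ ENNReal.toReal_nonneg

/-- A bound on `φₙ(y)` by a fixed `b` is, through the Galois connection, a bound on `ψₙ(b)` by `y`.
-/
theorem tendsto_pseudoInverse (h : IsArchimedeanGenerator ψ)
    (hs : ∀ n, IsArchimedeanGenerator (ψs n))
    (hψ : ∀ z, 0 ≤ z → Tendsto (fun n => ψs n z) atTop (𝓝 (ψ z))) {y : ℝ}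
    (hy : y ∈ Ioc (0 : ℝ) 1) :
    Tendsto (fun n => pseudoInverse (ψs n) y) atTop (𝓝 (pseudoInverse ψ y)) := by
  have hy' : y ∈ Icc (0 : ℝ) 1 := ⟨hy.1.le, hy.2⟩
  refine tendsto_order.2 ⟨fun a ha => ?_, fun a ha => ?_⟩
  · obtain ⟨b, hab, hb⟩ := exists_between ha
    rw [h.lt_pseudoInverse_iff hy'] at hb
    filter_upwards [(tendsto_extendTop hψ b).eventually_const_lt hb] with n hn
    exact hab.trans (((hs n).lt_pseudoInverse_iff hy' b).2 hn)
  · obtain ⟨b, hb, hba⟩ := exists_between ha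
    -- Strict because `ψ` is injective where it is positive; this is where `y > 0` is needed.
    have hb' : extendTop ψ b < y := by
      refine lt_of_le_of_ne ((h.pseudoInverse_le_iff hy' b).1 hb.le) fun he => ?_
      have := h.pseudoInverse_extendTop (he.symm ▸ hy.1)
      rw [he] at this
      exact hb.ne this
    filter_upwards [(tendsto_extendTop hψ b).eventually_lt_const hb'] with n hn
    exact (((hs n).pseudoInverse_le_iff hy' b).2 hn.le).trans_lt hba

theorem tendsto_of_tendsto_pseudoInverse (h : IsArchimedeanGenerator ψ)
    (hs : ∀ n, IsArchimedeanGenerator (ψs n))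
    (hφ : ∀ y ∈ Ioc (0 : ℝ) 1,
      Tendsto (fun n => pseudoInverse (ψs n) y) atTop (𝓝 (pseudoInverse ψ y))) {z : ℝ}
    (hz : 0 ≤ z) : Tendsto (fun n => ψs n z) atTop (𝓝 (ψ z)) := by
  refine tendsto_order.2 ⟨fun a ha => ?_, fun a ha => ?_⟩
  · by_cases ha0 : a < 0
    · exact Eventually.of_forall fun n => ha0.trans_le ((hs n).nonneg hz)
    · obtain ⟨b, hab, hb⟩ := exists_between ha
      have hb1 : b ∈ Ioc (0 : ℝ) 1 := ⟨(not_lt.1 ha0).trans_lt hab, hb.le.trans (h.le_one hz)⟩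
      rw [← extendTop_ofReal ψ hz, ← h.lt_pseudoInverse_iff ⟨hb1.1.le, hb1.2⟩] at hb
      filter_upwards [(hφ b hb1).eventually_const_lt hb] with n hn
      rw [(hs n).lt_pseudoInverse_iff ⟨hb1.1.le, hb1.2⟩, extendTop_ofReal _ hz] at hn
      exact hab.trans hn
  · by_cases ha1 : 1 < a
    · exact Eventually.of_forall fun n => ((hs n).le_one hz).trans_lt ha1
    · obtain ⟨b, hb, hba⟩ := exists_between ha
      have hb1 : b ∈ Ioc (0 : ℝ) 1 := ⟨(h.nonneg hz).trans_lt hb, hba.le.trans (not_lt.1 ha1)⟩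
      have hb2 : b ∈ Icc (0 : ℝ) 1 := ⟨hb1.1.le, hb1.2⟩
      have hlt : pseudoInverse ψ b < ENNReal.ofReal z := by
        refine lt_of_le_of_ne ((h.pseudoInverse_le_iff hb2 _).2
          (by rw [extendTop_ofReal ψ hz]; exact hb.le)) fun he => ?_
        have := h.extendTop_pseudoInverse hb2
        rw [he, extendTop_ofReal ψ hz] at this
        exact hb.ne this
      filter_upwards [(hφ b hb1).eventually_lt_const hlt] with n hn
      have := ((hs n).pseudoInverse_le_iff hb2 _).1 hn.le
      rw [extendTop_ofReal _ hz] at this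
      exact this.trans_lt hba

/-- Pointwise convergence of generators is uniform (Pólya). -/
theorem tendstoUniformlyOn_of_tendsto (h : IsArchimedeanGenerator ψ)
    (hs : ∀ n, IsArchimedeanGenerator (ψs n))
    (hψ : ∀ z, 0 ≤ z → Tendsto (fun n => ψs n z) atTop (𝓝 (ψ z))) :
    TendstoUniformlyOn ψs ψ atTop (Ici 0) := by
  rw [Metric.tendstoUniformlyOn_iff]
  intro ε hε
  obtain ⟨N, hN⟩ := exists_nat_gt (2 / ε)
  have hN0 : (0 : ℝ) < N := (div_pos two_pos hε).trans hN
  have hN1 : 0 < N := by exact_mod_cast hN0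
  have hε2 : 2 * (1 / (N : ℝ)) < ε := by
    rw [div_lt_iff₀ hε] at hN
    rw [← mul_div_assoc, mul_one, div_lt_iff₀ hN0]; linarith
  -- Equally spaced levels: `ψ` drops by `1 / N` between neighbouring points `p i`, and control of
  -- `ψs n` at these finitely many points costs another `1 / N`.
  let y : ℕ → ℝ := fun i => 1 - i * (1 / N)
  let p : ℕ → ℝ := fun i => (pseudoInverse ψ (y i)).toReal
  have hinv : (N : ℝ) * (1 / N) = 1 := by field_simp
  have hpos : (0 : ℝ) < 1 / N := by positivity
  have hy : ∀ i < N, y i ∈ Ioc (0 : ℝ) 1 := fun i hi => by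
    have hi' : (i : ℝ) < N := by exact_mod_cast hi
    have hi0 : (0 : ℝ) ≤ i := Nat.cast_nonneg i
    constructor
    · have := mul_lt_mul_of_pos_right hi' hpos
      simp only [y]; linarith
    · have := mul_nonneg hi0 hpos.le
      simp only [y]; linarith
  have hp0 : ∀ i, 0 ≤ p i := fun i => ENNReal.toReal_nonneg
  have hpy : ∀ i < N, ψ (p i) = y i := fun i hi => h.map_toReal_pseudoInverse (hy i hi)
  have hev : ∀ᶠ n in atTop, ∀ i ∈ Finset.range N, |ψs n (p i) - y i| < 1 / N := by
    rw [Filter.eventually_all_finset]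
    intro i hi
    have := hψ (p i) (hp0 i)
    rw [hpy i (Finset.mem_range.1 hi)] at this
    simpa [Real.dist_eq] using Metric.tendsto_nhds.1 this _ hpos
  filter_upwards [hev] with n hn z hz
  have hz0 : (0 : ℝ) ≤ z := hz
  obtain ⟨i, hi, hi1, hi2⟩ : ∃ i < N, ψ z ≤ y i ∧ y (i + 1) ≤ ψ z := by
    have hnn : 0 ≤ (1 - ψ z) * N := mul_nonneg (by linarith [h.le_one hz0]) hN0.le
    have hfl := Nat.floor_le hnn
    have hfl' := Nat.lt_floor_add_one ((1 - ψ z) * N)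
    have hz1 : ψ z = 1 - (1 - ψ z) * N * (1 / N) := by rw [mul_assoc, hinv]; ring
    by_cases hlt : ⌊(1 - ψ z) * N⌋₊ < N
    · refine ⟨_, hlt, ?_, ?_⟩
      · have := mul_le_mul_of_nonneg_right hfl hpos.le
        simp only [y]; linarith
      · have := mul_le_mul_of_nonneg_right hfl'.le hpos.le
        simp only [y]; push_cast; linarith
    · refine ⟨N - 1, by omega, ?_, ?_⟩
      · have h1 : (N : ℝ) ≤ (1 - ψ z) * N := le_trans (by exact_mod_cast not_lt.1 hlt) hfl
        have h2 : ψ z ≤ 0 := by nlinarith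
        exact h2.trans (hy _ (by omega)).1.le
      · simp only [y]
        rw [show N - 1 + 1 = N by omega, hinv, sub_self]
        exact h.nonneg hz0
  have hyi : y (i + 1) = y i - 1 / N := by simp only [y]; push_cast; ring
  have hu : ψs n z ≤ ψs n (p i) :=
    (hs n).antitoneOn (hp0 i) hz0 ((h.toReal_pseudoInverse_le_iff (hy i hi) hz0).2 hi1)
  have hu' := abs_lt.1 (hn i (Finset.mem_range.2 hi))
  have hl : y (i + 1) - 1 / N ≤ ψs n z := by
    by_cases hi' : i + 1 < N
    · have h1 : ψs n (p (i + 1)) ≤ ψs n z :=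
        (hs n).antitoneOn hz0 (hp0 _) ((h.le_toReal_pseudoInverse_iff (hy _ hi') hz0).2 hi2)
      have h2 := abs_lt.1 (hn _ (Finset.mem_range.2 hi'))
      linarith
    -- The bottom level may only be attained at `∞`; there nonnegativity of `ψs n` replaces the grid
    -- point.
    · have h1 : y (i + 1) = 0 := by
        simp only [y]; rw [show i + 1 = N by omega, hinv, sub_self]
      have := (hs n).nonneg hz0
      linarith
  rw [Real.dist_eq, abs_lt]
  constructor <;> linarith

end IsArchimedeanGenerator

namespace Copula

variable {d : ℕ}

/-- `[0,x]` outside `[0,y]` is covered by the slabs `yᵢ < zᵢ ≤ xᵢ`, whose masses are given by the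
uniform marginals. -/
theorem abs_cdf_sub_cdf_le (C : Copula d) (x y : Fin d → I) :
    |C.cdf x - C.cdf y| ≤ ∑ i, |(x i : ℝ) - y i| := by
  have key : ∀ x y : Fin d → I, C.cdf x - C.cdf y ≤ ∑ i, |(x i : ℝ) - y i| := fun x y => by
    have hsub : Iic x ⊆ Iic y ∪ ⋃ i, {z : Fin d → I | z i ∈ Ioc (y i) (x i)} := fun z hz => by
      by_cases hzy : z ≤ y
      · exact Or.inl hzy
      · rw [Pi.le_def] at hzy
        push Not at hzy
        obtain ⟨i, hi⟩ := hzy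
        exact Or.inr (mem_iUnion.2 ⟨i, hi, hz i⟩)
    have hi : ∀ i, C.measure.real {z : Fin d → I | z i ∈ Ioc (y i) (x i)} ≤
        |(x i : ℝ) - y i| := fun i => by
      have h1 := congrArg (fun μ => μ (Ioc (y i) (x i))) (C.map_eval i)
      simp only [unitInterval.volume_Ioc,
        Measure.map_apply (measurable_pi_apply i) measurableSet_Ioc] at h1
      have h2 : C.measure {z : Fin d → I | z i ∈ Ioc (y i) (x i)} =
        ENNReal.ofReal ((x i : ℝ) - y i) := h1
      rw [measureReal_def, h2, ENNReal.toReal_ofReal']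
      exact max_le (le_abs_self _) (abs_nonneg _)
    have h1 : C.cdf x ≤ C.cdf y + ∑ i, |(x i : ℝ) - y i| := by
      refine (measureReal_mono hsub).trans ((measureReal_union_le _ _).trans ?_)
      gcongr
      · exact le_rfl
      · exact (measureReal_iUnion_fintype_le _).trans (Finset.sum_le_sum fun i _ => hi i)
    linarith
  rw [abs_le]
  have h1 := key y x
  simp only [abs_sub_comm ((y _ : I) : ℝ)] at h1
  exact ⟨by linarith, key x y⟩

theorem lipschitzWith_cdf (C : Copula d) : LipschitzWith d C.cdf := by
  refine LipschitzWith.of_dist_le_mul fun x y => ?_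
  rw [Real.dist_eq]
  refine (C.abs_cdf_sub_cdf_le x y).trans ?_
  refine (Finset.sum_le_card_nsmul _ _ (dist x y) fun i _ => dist_le_pi_dist x y i).trans ?_
  simp

theorem tendstoUniformly_cdf {C : Copula d} {Cs : ℕ → Copula d}
    (h : ∀ x, Tendsto (fun n => (Cs n).cdf x) atTop (𝓝 (C.cdf x))) :
    TendstoUniformly (fun n => (Cs n).cdf) C.cdf atTop := by
  have heq : Equicontinuous fun n => (Cs n).cdf :=
    (LipschitzWith.uniformEquicontinuous _ d fun n => (Cs n).lipschitzWith_cdf).equicontinuous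
  have := (heq.tendsto_uniformFun_iff_pi atTop C.cdf).2 (tendsto_pi_nhds.2 h)
  exact UniformFun.tendsto_iff_tendstoUniformly.1 this

theorem cdf_eq_zero (C : Copula d) {x : Fin d → I} {i : Fin d} (hi : x i = 0) : C.cdf x = 0 := by
  rw [cdf, measureReal_def, C.measure_Iic_eq_zero hi, ENNReal.toReal_zero]

theorem tendsto_cdf_of_generator {C : Copula d} {Cs : ℕ → Copula d} {ψ : ℝ → ℝ} {ψs : ℕ → ℝ → ℝ}
    (hC : C.IsArchimedeanWith ψ) (hCs : ∀ n, (Cs n).IsArchimedeanWith (ψs n))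
    (hu : TendstoUniformlyOn ψs ψ atTop (Ici 0)) (x : Fin d → I) :
    Tendsto (fun n => (Cs n).cdf x) atTop (𝓝 (C.cdf x)) := by
  by_cases hx : ∀ i, 0 < x i
  · have hu' : TendstoUniformly (fun n => extendTop (ψs n)) (extendTop ψ) atTop := by
      rw [Metric.tendstoUniformly_iff]
      rw [Metric.tendstoUniformlyOn_iff] at hu
      intro ε hε
      filter_upwards [hu ε hε] with n hn z
      by_cases hz : z = ∞
      · simpa [hz, extendTop_top] using hε
      · simp only [extendTop_of_ne_top _ hz]; exact hn _ ENNReal.toReal_nonneg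
    have hsum : Tendsto (fun n => ∑ i, pseudoInverse (ψs n) (x i)) atTop
        (𝓝 (∑ i, pseudoInverse ψ (x i))) :=
      tendsto_finsetSum _ fun i _ => hC.generator.tendsto_pseudoInverse
        (fun n => (hCs n).generator) (fun z hz => hu.tendsto_at hz) ⟨hx i, (x i).2.2⟩
    have := hu'.tendsto_comp hC.generator.continuous_extendTop.continuousAt hsum
    simpa only [hC.cdf_eq, fun n => (hCs n).cdf_eq x] using this
  -- `φₙ(0)` need not converge to `φ(0)`, but all copulas vanish when a coordinate is zero.
  · push Not at hx
    obtain ⟨i, hi⟩ := hx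
    have hi0 : x i = 0 := le_antisymm hi unitInterval.nonneg'
    simp [fun C : Copula d => C.cdf_eq_zero hi0]

end Copula

end GeneratorConvergence

/-! ### Recovering the normalized generator from the copula. -/

section CopulaToGenerator

theorem exists_dyadic_between {z w : ℝ} (hz : 0 ≤ z) (hzw : z < w) :
    ∃ m j : ℕ, z < m * (1 / 2 : ℝ) ^ j ∧ m * (1 / 2 : ℝ) ^ j < w := by
  obtain ⟨j, hj⟩ := exists_pow_lt_of_lt_one (sub_pos.2 hzw) (by norm_num : (1 / 2 : ℝ) < 1)
  have hp : (0 : ℝ) < (1 / 2) ^ j := by positivity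
  have h0 : 0 ≤ z / (1 / 2) ^ j := div_nonneg hz hp.le
  refine ⟨⌊z / (1 / 2) ^ j⌋₊ + 1, j, ?_, ?_⟩
  · rw [← div_lt_iff₀ hp]; push_cast; exact Nat.lt_floor_add_one _
  · have := (le_div_iff₀ hp).1 (Nat.floor_le h0)
    push_cast; linarith

namespace Copula

/-- The bivariate margin of the first two coordinates. -/
noncomputable def cdf₂ {n : ℕ} (C : Copula (n + 2)) (u v : I) : ℝ :=
  C.cdf (Fin.cons u (Fin.cons v fun _ => 1))

variable {n : ℕ} {C : Copula (n + 2)} {Cs : ℕ → Copula (n + 2)} {ψ : ℝ → ℝ} {ψs : ℕ → ℝ → ℝ}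

theorem IsArchimedeanWith.cdf₂_generatorPoint (hC : C.IsArchimedeanWith ψ) {s t : ℝ} (hs : 0 ≤ s)
    (ht : 0 ≤ t) : C.cdf₂ (generatorPoint ψ s) (generatorPoint ψ t) = ψ (s + t) := by
  have h1 : generatorPoint ψ 0 = 1 := Subtype.ext (by
    rw [hC.generator.coe_generatorPoint le_rfl, hC.generator.map_zero]; rfl)
  have h2 := hC.cdf_generatorPoint (Fin.cons s (Fin.cons t fun _ => 0))
    (Fin.cases hs (Fin.cases ht fun _ => le_rfl))
  simp only [Fin.sum_univ_succ, Fin.cons_zero, Fin.cons_succ, Finset.sum_const_zero,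
    add_zero] at h2
  rw [← h2, cdf₂]
  congr 1
  ext i
  refine Fin.cases rfl (fun i => Fin.cases rfl (fun i => ?_) i) i
  simp [h1]

theorem cdf₂_mono (C : Copula (n + 2)) {u v u' v' : I} (hu : u ≤ u') (hv : v ≤ v') :
    C.cdf₂ u v ≤ C.cdf₂ u' v' :=
  measureReal_mono (Iic_subset_Iic.2
    (Fin.cases hu (Fin.cases hv fun _ => le_rfl)))

theorem abs_cdf₂_sub_le (C : Copula (n + 2)) (u v u' v' : I) :
    |C.cdf₂ u v - C.cdf₂ u' v'| ≤ |(u : ℝ) - u'| + |(v : ℝ) - v'| := by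
  refine (C.abs_cdf_sub_cdf_le _ _).trans (le_of_eq ?_)
  simp [Fin.sum_univ_succ]

/-- `ψₙ(s+t)` is the bivariate margin of `Cₙ` at `(ψₙ(s), ψₙ(t))`. The Lipschitz bound, uniform in
`n`, replaces the moving point by `(ψ(s), ψ(t))`. -/
theorem tendsto_generator_add (hC : C.IsArchimedeanWith ψ)
    (hCs : ∀ n, (Cs n).IsArchimedeanWith (ψs n))
    (h : ∀ x, Tendsto (fun n => (Cs n).cdf x) atTop (𝓝 (C.cdf x))) {s t : ℝ} (hs : 0 ≤ s)
    (ht : 0 ≤ t) (hψs : Tendsto (fun n => ψs n s) atTop (𝓝 (ψ s)))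
    (hψt : Tendsto (fun n => ψs n t) atTop (𝓝 (ψ t))) :
    Tendsto (fun n => ψs n (s + t)) atTop (𝓝 (ψ (s + t))) := by
  have h1 : Tendsto (fun n => (Cs n).cdf₂ (generatorPoint ψ s) (generatorPoint ψ t)) atTop
      (𝓝 (ψ (s + t))) := by
    rw [← hC.cdf₂_generatorPoint hs ht]; exact h _
  have h2 : Tendsto (fun n => |ψs n s - ψ s| + |ψs n t - ψ t|) atTop (𝓝 0) := by
    have e1 : Tendsto (fun n => |ψs n s - ψ s|) atTop (𝓝 0) := by
      simpa using (hψs.sub_const (ψ s)).abs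
    have e2 : Tendsto (fun n => |ψs n t - ψ t|) atTop (𝓝 0) := by
      simpa using (hψt.sub_const (ψ t)).abs
    simpa using e1.add e2
  have h3 : Tendsto (fun n => ψs n (s + t) -
      (Cs n).cdf₂ (generatorPoint ψ s) (generatorPoint ψ t)) atTop (𝓝 0) := by
    refine squeeze_zero_norm (fun n => ?_) h2
    have := (Cs n).abs_cdf₂_sub_le (generatorPoint (ψs n) s) (generatorPoint (ψs n) t)
      (generatorPoint ψ s) (generatorPoint ψ t)
    rwa [(hCs n).cdf₂_generatorPoint hs ht, (hCs n).generator.coe_generatorPoint hs,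
      (hCs n).generator.coe_generatorPoint ht, hC.generator.coe_generatorPoint hs,
      hC.generator.coe_generatorPoint ht] at this
  simpa using h3.add h1

/-- On the diagonal, `ψ(s)` is the solution `u` of `C(u,u) = ψ(2s)`, isolated because the diagonal
is strictly increasing near a positive value. For `b < ψ(s)` this gives `Cₙ(b,b) < ψₙ(2s) =
Cₙ(ψₙ(s),ψₙ(s))` eventually, so `b < ψₙ(s)` by monotonicity; `b > ψ(s)` is symmetric. -/
theorem tendsto_generator_half (hC : C.IsArchimedeanWith ψ)
    (hCs : ∀ n, (Cs n).IsArchimedeanWith (ψs n))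
    (h : ∀ x, Tendsto (fun n => (Cs n).cdf x) atTop (𝓝 (C.cdf x))) {s : ℝ} (hs : 0 ≤ s)
    (hp : 0 < ψ (s + s)) (hψ : Tendsto (fun n => ψs n (s + s)) atTop (𝓝 (ψ (s + s)))) :
    Tendsto (fun n => ψs n s) atTop (𝓝 (ψ s)) := by
  have hg := hC.generator
  have key : ∀ b : I, 0 < b → Tendsto (fun n => (Cs n).cdf₂ b b) atTop
      (𝓝 (ψ ((pseudoInverse ψ b).toReal + (pseudoInverse ψ b).toReal))) := fun b hb => by
    rw [← hC.cdf₂_generatorPoint ENNReal.toReal_nonneg ENNReal.toReal_nonneg]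
    have : generatorPoint ψ (pseudoInverse ψ b).toReal = b := Subtype.ext (by
      rw [hg.coe_generatorPoint ENNReal.toReal_nonneg, hg.map_toReal_pseudoInverse ⟨hb, b.2.2⟩])
    rw [this]; exact h _
  refine tendsto_order.2 ⟨fun a ha => ?_, fun a ha => ?_⟩
  · by_cases ha0 : a < 0
    · exact Eventually.of_forall fun n => ha0.trans_le ((hCs n).generator.nonneg hs)
    obtain ⟨b, hab, hb⟩ := exists_between ha
    have hb1 : b ∈ Ioc (0 : ℝ) 1 := ⟨(not_lt.1 ha0).trans_lt hab, hb.le.trans (hg.le_one hs)⟩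
    have hsb : s < (pseudoInverse ψ b).toReal := by
      by_contra! hle
      exact hb.not_ge ((hg.toReal_pseudoInverse_le_iff hb1 hs).1 hle)
    have hlt := hg.lt_of_lt_of_pos (add_nonneg hs hs) (add_lt_add hsb hsb) hp
    obtain ⟨c, hc1, hc2⟩ := exists_between hlt
    filter_upwards [(key ⟨b, hb1.1.le, hb1.2⟩ hb1.1).eventually_lt_const hc1,
      hψ.eventually_const_lt hc2] with n hn hn'
    refine hab.trans ?_
    by_contra! hle
    have := (Cs n).cdf₂_mono (u := generatorPoint (ψs n) s) (v := generatorPoint (ψs n) s)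
      (u' := ⟨b, hb1.1.le, hb1.2⟩) (v' := ⟨b, hb1.1.le, hb1.2⟩)
      (by rwa [← Subtype.coe_le_coe, (hCs n).generator.coe_generatorPoint hs])
      (by rwa [← Subtype.coe_le_coe, (hCs n).generator.coe_generatorPoint hs])
    rw [(hCs n).cdf₂_generatorPoint hs hs] at this
    linarith
  · by_cases ha1 : 1 < a
    · exact Eventually.of_forall fun n => ((hCs n).generator.le_one hs).trans_lt ha1
    obtain ⟨b, hb, hba⟩ := exists_between ha
    have hb1 : b ∈ Ioc (0 : ℝ) 1 := ⟨(hg.nonneg hs).trans_lt hb, hba.le.trans (not_lt.1 ha1)⟩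
    have hsb : (pseudoInverse ψ b).toReal < s := by
      by_contra! hle
      exact hb.not_ge ((hg.le_toReal_pseudoInverse_iff hb1 hs).1 hle)
    have h0 : 0 ≤ (pseudoInverse ψ b).toReal := ENNReal.toReal_nonneg
    have hlt := hg.lt_of_lt_of_pos (add_nonneg h0 h0) (add_lt_add hsb hsb)
      (hp.trans_le (hg.antitoneOn (add_nonneg h0 h0) (add_nonneg hs hs) (add_le_add hsb.le hsb.le)))
    obtain ⟨c, hc1, hc2⟩ := exists_between hlt
    filter_upwards [(key ⟨b, hb1.1.le, hb1.2⟩ hb1.1).eventually_const_lt hc2,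
      hψ.eventually_lt_const hc1] with n hn hn'
    refine lt_trans ?_ hba
    by_contra! hle
    have := (Cs n).cdf₂_mono (u' := generatorPoint (ψs n) s) (v' := generatorPoint (ψs n) s)
      (u := ⟨b, hb1.1.le, hb1.2⟩) (v := ⟨b, hb1.1.le, hb1.2⟩)
      (by rwa [← Subtype.coe_le_coe, (hCs n).generator.coe_generatorPoint hs])
      (by rwa [← Subtype.coe_le_coe, (hCs n).generator.coe_generatorPoint hs])
    rw [(hCs n).cdf₂_generatorPoint hs hs] at this
    linarith

/-- Pointwise convergence of Archimedean copulas forces convergence of the normalized generators: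
first at `2⁻ʲ` by solving `C(u,u) = ψ(2⁻ʲ⁺¹)`, then at dyadic numbers by addition. -/
theorem tendsto_generator_of_tendsto_cdf (hC : C.IsArchimedeanWith ψ)
    (hCs : ∀ n, (Cs n).IsArchimedeanWith (ψs n))
    (h : ∀ x, Tendsto (fun n => (Cs n).cdf x) atTop (𝓝 (C.cdf x))) {z : ℝ} (hz : 0 ≤ z) :
    Tendsto (fun n => ψs n z) atTop (𝓝 (ψ z)) := by
  have hg := hC.generator
  have h0 : Tendsto (fun n => ψs n 0) atTop (𝓝 (ψ 0)) := by
    simp [hg.map_zero, fun n => (hCs n).generator.map_zero]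
  have hpow : ∀ j : ℕ, Tendsto (fun n => ψs n ((1 / 2 : ℝ) ^ j)) atTop
      (𝓝 (ψ ((1 / 2 : ℝ) ^ j))) := fun j => by
    induction j with
    | zero => simp [hg.normalized, fun n => (hCs n).generator.normalized]
    | succ j ih =>
      have he : (1 / 2 : ℝ) ^ (j + 1) + (1 / 2 : ℝ) ^ (j + 1) = (1 / 2) ^ j := by ring
      refine tendsto_generator_half hC hCs h (by positivity) ?_ (by rwa [he])
      rw [he]
      -- Positivity comes from the normalization: `ψ ≥ 1/2` on `[0,1]`.
      have h1 : (1 / 2 : ℝ) ^ j ≤ 1 := pow_le_one₀ (by norm_num) (by norm_num)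
      have h2 := hg.antitoneOn (show (0 : ℝ) ≤ (1 / 2) ^ j by positivity)
        (show (0 : ℝ) ≤ 1 by norm_num) h1
      rw [hg.normalized] at h2
      linarith
  have hdy : ∀ m j : ℕ, Tendsto (fun n => ψs n (m * (1 / 2 : ℝ) ^ j)) atTop
      (𝓝 (ψ (m * (1 / 2 : ℝ) ^ j))) := fun m j => by
    induction m with
    | zero => simpa using h0
    | succ m ih =>
      have := tendsto_generator_add hC hCs h (by positivity) (by positivity) ih (hpow j)
      simpa [add_mul] using this
  rcases hz.eq_or_lt with rfl | hz0
  · exact h0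
  have hcont : ContinuousAt ψ z := hg.continuousOn.continuousAt (Ici_mem_nhds hz0)
  refine tendsto_order.2 ⟨fun a ha => ?_, fun a ha => ?_⟩
  · have h1 : ∀ᶠ w in 𝓝[>] z, a < ψ w ∧ z < w :=
      ((hcont.eventually_const_lt ha).filter_mono nhdsWithin_le_nhds).and self_mem_nhdsWithin
    obtain ⟨w, haw, hzw⟩ := h1.exists
    obtain ⟨m, j, hm1, hm2⟩ := exists_dyadic_between hz hzw
    have h2 : a < ψ (m * (1 / 2 : ℝ) ^ j) :=
      haw.trans_le (hg.antitoneOn (hz.trans hm1.le) (hz.trans hzw.le) hm2.le)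
    filter_upwards [(hdy m j).eventually_const_lt h2] with n hn
    exact hn.trans_le ((hCs n).generator.antitoneOn hz (hz.trans hm1.le) hm1.le)
  · have h1 : ∀ᶠ w in 𝓝[<] z, ψ w < a ∧ 0 < w ∧ w < z :=
      ((hcont.eventually_lt_const ha).filter_mono nhdsWithin_le_nhds).and
        (((lt_mem_nhds hz0).filter_mono nhdsWithin_le_nhds).and self_mem_nhdsWithin)
    obtain ⟨w, haw, hw0, hzw⟩ := h1.exists
    obtain ⟨m, j, hm1, hm2⟩ := exists_dyadic_between hw0.le hzw
    have hm0 : (0 : ℝ) ≤ m * (1 / 2 : ℝ) ^ j := hw0.le.trans hm1.le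
    have h2 : ψ (m * (1 / 2 : ℝ) ^ j) < a := (hg.antitoneOn hw0.le hm0 hm1.le).trans_lt haw
    filter_upwards [(hdy m j).eventually_lt_const h2] with n hn
    exact ((hCs n).generator.antitoneOn hm0 hz hm2.le).trans_lt hn

end Copula

end CopulaToGenerator

/-! ### Convergence of derivatives. -/

section DerivativeConvergence

namespace IsArchimedeanGenerator

variable {ψ : ℝ → ℝ} {ψs : ℕ → ℝ → ℝ} {k : ℕ}

theorem negLeftDerivIter_eqOn (h : IsArchimedeanGenerator ψ)
    (hm : IsMultiplyMonotone (k + 1) ψ) {m : ℕ} (hmk : m < k) :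
    EqOn (negLeftDerivIter ψ m) (fun z => (-1) ^ m * iteratedDeriv m ψ z) (Ioi 0) := by
  obtain ⟨j, rfl⟩ := Nat.exists_eq_add_of_lt hmk
  exact (IsMultiplyMonotone.negLeftDerivIter (h.continuousOn.mono Ioi_subset_Ici_self) m j
    (by rwa [show j + 2 + m = m + j + 1 + 1 by ring])).2.2

theorem iteratedDeriv_eqOn (h : IsArchimedeanGenerator ψ)
    (hm : IsMultiplyMonotone (k + 1) ψ) {m : ℕ} (hmk : m < k) :
    EqOn (iteratedDeriv m ψ) (fun z => (-1) ^ m * negLeftDerivIter ψ m z) (Ioi 0) := fun z hz => by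
  simp only [h.negLeftDerivIter_eqOn hm hmk hz, ← mul_assoc, ← mul_pow]
  norm_num

theorem leftDeriv_iteratedDeriv (h : IsArchimedeanGenerator ψ)
    (hm : IsMultiplyMonotone (k + 1) ψ) (hk : 0 < k) {z : ℝ} (hz : 0 < z) :
    leftDeriv (iteratedDeriv (k - 1) ψ) z = (-1) ^ k * negLeftDerivIter ψ k z := by
  obtain ⟨j, rfl⟩ := Nat.exists_eq_succ_of_ne_zero hk.ne'
  rw [leftDeriv_congr (h.iteratedDeriv_eqOn hm (by simp)) hz]
  simp only [leftDeriv, Nat.succ_eq_add_one, add_tsub_cancel_right, negLeftDerivIter,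
    derivWithin_const_mul_field]
  ring

theorem differentiableOn_negLeftDerivIter (h : IsArchimedeanGenerator ψ)
    (hm : IsMultiplyMonotone (k + 1) ψ) {m : ℕ} (hmk : m + 1 < k) :
    DifferentiableOn ℝ (negLeftDerivIter ψ m) (Ioi 0) := by
  obtain ⟨j, rfl⟩ := Nat.exists_eq_add_of_lt hmk
  have := IsMultiplyMonotone.negLeftDerivIter (h.continuousOn.mono Ioi_subset_Ici_self) m (j + 1)
    (by rwa [show j + 1 + 2 + m = m + 1 + j + 1 + 1 by ring])
  exact this.1.differentiableOn this.2.1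

theorem contDiffOn (h : IsArchimedeanGenerator ψ) (hm : IsMultiplyMonotone (k + 1) ψ)
    (hk : 0 < k) : ContDiffOn ℝ ((k - 1 : ℕ) : ℕ∞) ψ (Ioi 0) := by
  refine contDiffOn_of_continuousOn_differentiableOn_deriv (fun m hmk => ?_) fun m hmk => ?_
  · have hmk' : m < k := by
      have : m ≤ k - 1 := by exact_mod_cast hmk
      omega
    refine (((h.convexOn_negLeftDerivIter hm hmk').continuousOn isOpen_Ioi).const_smul
      ((-1 : ℝ) ^ m)).congr fun z hz => ?_
    rw [iteratedDerivWithin_of_isOpen isOpen_Ioi hz, h.iteratedDeriv_eqOn hm hmk' hz]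
    rfl
  · have hmk' : m + 1 < k := by
      have : m < k - 1 := by exact_mod_cast hmk
      omega
    refine ((h.differentiableOn_negLeftDerivIter hm hmk').const_smul
      ((-1 : ℝ) ^ m)).congr fun z hz => ?_
    rw [iteratedDerivWithin_of_isOpen isOpen_Ioi hz, h.iteratedDeriv_eqOn hm (by omega) hz]
    rfl

theorem differentiableWithinAt_iteratedDeriv (h : IsArchimedeanGenerator ψ)
    (hm : IsMultiplyMonotone (k + 1) ψ) (hk : 0 < k) {z : ℝ} (hz : 0 < z) :
    DifferentiableWithinAt ℝ (iteratedDeriv (k - 1) ψ) (Iic z) z := by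
  have hk' : k - 1 < k := by omega
  have h1 := ((h.convexOn_negLeftDerivIter hm hk').hasDerivWithinAt_leftDeriv_Ioi
    hz).differentiableWithinAt.const_mul ((-1 : ℝ) ^ (k - 1))
  refine h1.congr_of_eventuallyEq ?_ (h.iteratedDeriv_eqOn hm hk' hz)
  exact mem_nhdsWithin_of_mem_nhds
    (by filter_upwards [Ioi_mem_nhds hz] with x hx using h.iteratedDeriv_eqOn hm hk' hx)

/-- Orders below `k` are convex, hence continuous, so they converge everywhere and feed the next
order; only order `k` can jump. The arguments `zs n` vary because the densities are evaluated at
`φₙ(xᵢ)`. -/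
theorem tendsto_negLeftDerivIter (h : IsArchimedeanGenerator ψ)
    (hs : ∀ n, IsArchimedeanGenerator (ψs n)) (hm : IsMultiplyMonotone (k + 1) ψ)
    (hms : ∀ n, IsMultiplyMonotone (k + 1) (ψs n))
    (hψ : ∀ z, 0 ≤ z → Tendsto (fun n => ψs n z) atTop (𝓝 (ψ z))) {m : ℕ} (hmk : m < k) {z : ℝ}
    (hz : 0 < z) (hc : ContinuousAt (negLeftDerivIter ψ (m + 1)) z) {zs : ℕ → ℝ}
    (hzs : Tendsto zs atTop (𝓝 z)) :
    Tendsto (fun n => negLeftDerivIter (ψs n) (m + 1) (zs n)) atTop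
      (𝓝 (negLeftDerivIter ψ (m + 1) z)) := by
  induction m generalizing z zs with
  | zero =>
    refine (tendsto_leftDeriv (fun n => (hs n).convexOn_negLeftDerivIter (hms n) hmk)
      (h.convexOn_negLeftDerivIter hm hmk) (fun z hz => hψ z hz.le) hz ?_ hzs).neg
    have hc' := hc.neg
    simpa only [Pi.neg_def, negLeftDerivIter, neg_neg] using hc'
  | succ m ih =>
    refine (tendsto_leftDeriv (fun n => (hs n).convexOn_negLeftDerivIter (hms n) hmk)
      (h.convexOn_negLeftDerivIter hm hmk) (fun z hz => ?_) hz ?_ hzs).neg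
    · exact ih (Nat.lt_of_succ_lt hmk) hz (((h.convexOn_negLeftDerivIter hm hmk).continuousOn
        isOpen_Ioi).continuousAt (Ioi_mem_nhds hz)) tendsto_const_nhds
    · have hc' := hc.neg
      simpa only [Pi.neg_def, negLeftDerivIter, neg_neg] using hc'

theorem neg_leftDeriv_le (h : IsArchimedeanGenerator ψ) (hcv : ConvexOn ℝ (Ioi 0) ψ) {p s : ℝ}
    (hp : 0 < p) (hps : p ≤ s) : |leftDeriv ψ s| ≤ 2 / p := by
  have hs0 := hp.trans_le hps
  rw [abs_of_nonpos (hcv.leftDeriv_nonpos_of_antitoneOn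
    (h.antitoneOn.mono Ioi_subset_Ici_self) hs0)]
  -- `ψ` falls by at most 1 over `[p/2, p]`, so its slope there is at least `-2/p`. This bound,
  -- common to all generators, dominates the integrands in the next lemma.
  have h1 := hcv.slope_le_leftDeriv_Ioi (half_pos hp) (half_lt_self hp)
  have h2 := hcv.monotoneOn_leftDeriv_Ioi hp hs0 hps
  have h3 := h.nonneg hp.le
  have h4 := h.le_one (half_pos hp).le
  rw [slope_def_field] at h1
  have h5 : -(2 / p) ≤ (ψ p - ψ (p / 2)) / (p - p / 2) := by
    rw [le_div_iff₀ (by linarith), show -(2 / p) * (p - p / 2) = -1 by field_simp; ring]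
    linarith
  linarith

/-- Normalized convex generators converge once their derivatives do. -/
theorem tendsto_of_tendsto_leftDeriv (h : IsArchimedeanGenerator ψ)
    (hs : ∀ n, IsArchimedeanGenerator (ψs n)) (hcv : ConvexOn ℝ (Ioi 0) ψ)
    (hcvs : ∀ n, ConvexOn ℝ (Ioi 0) (ψs n))
    (hd : ∀ z > 0, Tendsto (fun n => leftDeriv (ψs n) z) atTop (𝓝 (leftDeriv ψ z))) {z : ℝ}
    (hz : 0 ≤ z) : Tendsto (fun n => ψs n z) atTop (𝓝 (ψ z)) := by
  have key : ∀ p b : ℝ, 0 < p → p ≤ b →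
      Tendsto (fun n => ψs n b - ψs n p) atTop (𝓝 (ψ b - ψ p)) := fun p b hp hpb => by
    rw [← (hcv.integral_leftDeriv hp hpb).2]
    simp only [fun n => ((hcvs n).integral_leftDeriv hp hpb).2.symm]
    refine intervalIntegral.tendsto_integral_filter_of_dominated_convergence (fun _ => 2 / p)
      (Eventually.of_forall fun n => by
        rw [uIoc_of_le hpb]
        exact ((hcvs n).integral_leftDeriv hp hpb).1.1.aestronglyMeasurable)
      (Eventually.of_forall fun n => ae_of_all _ fun s hs' => ?_) intervalIntegrable_const
      (ae_of_all _ fun s hs' => ?_)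
    · rw [uIoc_of_le hpb] at hs'
      exact (hs n).neg_leftDeriv_le (hcvs n) hp hs'.1.le
    · rw [uIoc_of_le hpb] at hs'
      exact hd s (hp.trans hs'.1)
  have h1 : Tendsto (fun n => ψs n 1) atTop (𝓝 (ψ 1)) := by
    simp [h.normalized, fun n => (hs n).normalized]
  rcases hz.eq_or_lt with rfl | hz0
  · simp [h.map_zero, fun n => (hs n).map_zero]
  rcases le_total z 1 with hz1 | hz1
  · simpa using h1.sub (key z 1 hz0 hz1)
  · simpa using h1.add (key 1 z one_pos hz1)

end IsArchimedeanGenerator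

end DerivativeConvergence

/-! ### Weak convergence on the unit interval and a Scheffé-type lemma. -/

section WeakConvergence

/-- Convergence of distribution functions on a dense set implies weak convergence. -/
theorem tendsto_probabilityMeasure_of_tendsto_Iic {μs : ℕ → ProbabilityMeasure I}
    {μ : ProbabilityMeasure I} {Q : Set I} (hQ : Dense Q) (hQ1 : 1 ∈ Q)
    (h : ∀ y ∈ Q, 0 < y → Tendsto (fun n => (μs n : Measure I) (Iic y)) atTop
      (𝓝 ((μ : Measure I) (Iic y)))) : Tendsto μs atTop (𝓝 μ) := by
  let P : I → Prop := fun y => y ∈ Q ∧ 0 < y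
  have hmin : ∀ {a b}, P a → P b → P (a ⊓ b) := fun {a b} ha hb => by
    rcases le_total a b with hab | hab <;> simpa [hab]
  have hmax : ∀ {a b}, P a → P b → P (a ⊔ b) := fun {a b} ha hb => by
    rcases le_total a b with hab | hab <;> simpa [hab]
  -- The sets `Iic b` serve as neighbourhoods of `0`, since no endpoint is allowed to be `0`;
  -- neighbourhoods of `1` need `1 ∈ Q`.
  let S : Set (Set I) := {s | (∃ b, P b ∧ s = Iic b) ∨ ∃ a b, P a ∧ P b ∧ s = Ioc a b}
  have hS : IsPiSystem S := by
    rintro _ (⟨b, hb, rfl⟩ | ⟨a, b, ha, hb, rfl⟩) _ (⟨d, hd, rfl⟩ | ⟨c, d, hc, hd, rfl⟩) -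
    · exact Or.inl ⟨b ⊓ d, hmin hb hd, Iic_inter_Iic⟩
    · refine Or.inr ⟨c, b ⊓ d, hc, hmin hb hd, ?_⟩
      ext x; simp only [mem_inter_iff, mem_Iic, mem_Ioc, le_inf_iff]; tauto
    · refine Or.inr ⟨a, b ⊓ d, ha, hmin hb hd, ?_⟩
      ext x; simp only [mem_inter_iff, mem_Iic, mem_Ioc, le_inf_iff]; tauto
    · exact Or.inr ⟨a ⊔ c, b ⊓ d, hmax ha hc, hmin hb hd, Ioc_inter_Ioc⟩
  have hI : ∀ y, P y → Tendsto (fun n => μs n (Iic y)) atTop (𝓝 (μ (Iic y))) := fun y hy =>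
    (ENNReal.tendsto_toNNReal (measure_ne_top _ _)).comp (h y hy.1 hy.2)
  have hIoc : ∀ (ν : ProbabilityMeasure I) (a b : I), ν (Ioc a b) = ν (Iic b) - ν (Iic a) :=
    fun ν a b => by
      rw [← ENNReal.coe_inj, ENNReal.coe_sub]
      simp only [ProbabilityMeasure.ennreal_coeFn_eq_coeFn_toMeasure]
      rcases le_total a b with hab | hab
      · rw [← Iic_sdiff_Iic, measure_sdiff (Iic_subset_Iic.2 hab)
          measurableSet_Iic.nullMeasurableSet (measure_ne_top _ _)]
      · rw [Ioc_eq_empty hab.not_gt, measure_empty,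
          tsub_eq_zero_of_le (measure_mono (Iic_subset_Iic.2 hab))]
  refine hS.tendsto_probabilityMeasure_of_tendsto_of_mem ?_ (fun u hu x hx => ?_) ?_
  · rintro _ (⟨b, -, rfl⟩ | ⟨a, b, -, -, rfl⟩)
    exacts [measurableSet_Iic, measurableSet_Ioc]
  · have hux := hu.mem_nhds hx
    obtain ⟨b, hb, hxb, hbn, hbu⟩ : ∃ b, P b ∧ x ≤ b ∧ Iic b ∈ 𝓝 x ∧ Icc x b ⊆ u := by
      by_cases hx1 : x = 1
      · subst hx1
        refine ⟨1, ⟨hQ1, zero_lt_one⟩, le_rfl, ?_, by simpa using hx⟩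
        exact Filter.mem_of_superset univ_mem fun y _ => unitInterval.le_one'
      · have hx1' : x < 1 := lt_of_le_of_ne unitInterval.le_one' hx1
        obtain ⟨l, hl, hlu⟩ := exists_Ico_subset_of_mem_nhds hux ⟨1, hx1'⟩
        obtain ⟨b, hbQ, hxb, hbl⟩ := hQ.exists_between hl
        exact ⟨b, ⟨hbQ, lt_of_le_of_lt unitInterval.nonneg' hxb⟩, hxb.le, Iic_mem_nhds hxb,
          fun y hy => hlu ⟨hy.1, hy.2.trans_lt hbl⟩⟩
    by_cases hx0 : x = 0
    · subst hx0
      exact ⟨Iic b, Or.inl ⟨b, hb, rfl⟩, hbn, fun y hy => hbu ⟨unitInterval.nonneg', hy⟩⟩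
    · have hx0' : 0 < x := lt_of_le_of_ne unitInterval.nonneg' (Ne.symm hx0)
      obtain ⟨l, hl, hlu⟩ := exists_Ioc_subset_of_mem_nhds hux ⟨0, hx0'⟩
      obtain ⟨a, haQ, hla, hax⟩ := hQ.exists_between hl
      refine ⟨Ioc a b, Or.inr ⟨a, b, ⟨haQ, lt_of_le_of_lt unitInterval.nonneg' hla⟩, hb, rfl⟩,
        ?_, fun y hy => ?_⟩
      · rw [← Ioi_inter_Iic]; exact inter_mem (Ioi_mem_nhds hax) hbn
      · rcases le_total y x with hyx | hyx
        · exact hlu ⟨hla.trans hy.1, hyx⟩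
        · exact hbu ⟨hyx, hy.2⟩
  · rintro _ (⟨b, hb, rfl⟩ | ⟨a, b, ha, hb, rfl⟩)
    · exact hI b hb
    · simp only [hIoc]
      exact (hI b hb).sub (hI a ha)

/-- If nonnegative functions `gₙ → g` and `hₙ → h` converge a.e. and `gₙ + hₙ`, `g + h` have
integral one, then the integrals of `gₙ` converge. -/
theorem tendsto_lintegral_of_add_eq_one {α : Type*} [MeasurableSpace α] {μ : Measure α}
    {gs hs : ℕ → α → ℝ≥0∞} {g h : α → ℝ≥0∞} (hgs : ∀ n, AEMeasurable (gs n) μ)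
    (hhs : ∀ n, AEMeasurable (hs n) μ)
    (hg : ∀ᵐ x ∂μ, Tendsto (fun n => gs n x) atTop (𝓝 (g x)))
    (hh : ∀ᵐ x ∂μ, Tendsto (fun n => hs n x) atTop (𝓝 (h x)))
    (hsum : ∀ n, ∫⁻ x, gs n x ∂μ + ∫⁻ x, hs n x ∂μ = 1)
    (hsum' : ∫⁻ x, g x ∂μ + ∫⁻ x, h x ∂μ = 1) :
    Tendsto (fun n => ∫⁻ x, gs n x ∂μ) atTop (𝓝 (∫⁻ x, g x ∂μ)) := by
  have fatou : ∀ {fs : ℕ → α → ℝ≥0∞} {f : α → ℝ≥0∞}, (∀ n, AEMeasurable (fs n) μ) →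
      (∀ᵐ x ∂μ, Tendsto (fun n => fs n x) atTop (𝓝 (f x))) →
      ∫⁻ x, f x ∂μ ≤ liminf (fun n => ∫⁻ x, fs n x ∂μ) atTop := fun hfs hf => by
    refine le_trans (le_of_eq (lintegral_congr_ae ?_)) (lintegral_liminf_le' hfs)
    filter_upwards [hf] with x hx using hx.liminf_eq.symm
  refine tendsto_order.2 ⟨fun a ha => eventually_lt_of_lt_liminf (ha.trans_le (fatou hgs hg)),
    fun b hb => ?_⟩
  have hle : ∀ n, ∫⁻ x, gs n x ∂μ ≤ 1 := fun n => hsum n ▸ le_self_add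
  by_cases hb1 : 1 < b
  · exact Eventually.of_forall fun n => (hle n).trans_lt hb1
  have hh1 : ∫⁻ x, h x ∂μ ≠ ∞ := ne_top_of_le_ne_top ENNReal.one_ne_top (hsum' ▸ le_add_self)
  -- Fatou for the complementary functions `hs` bounds the integrals of `gs` from above, because the
  -- two integrals always add up to one.
  have h1 : 1 - b < ∫⁻ x, h x ∂μ := by
    refine ENNReal.sub_lt_of_lt_add (not_lt.1 hb1) ?_
    rw [← hsum', add_comm]
    exact ENNReal.add_lt_add_left hh1 hb
  filter_upwards [eventually_lt_of_lt_liminf (h1.trans_le (fatou hhs hh))] with n hn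
  by_contra! hle'
  have hb2 : b ≠ ∞ := ne_top_of_le_ne_top ENNReal.one_ne_top (not_lt.1 hb1)
  have h2 : 1 < ∫⁻ x, gs n x ∂μ + ∫⁻ x, hs n x ∂μ := by
    calc (1 : ℝ≥0∞) = b + (1 - b) := (add_tsub_cancel_of_le (not_lt.1 hb1)).symm
      _ < b + ∫⁻ x, hs n x ∂μ := ENNReal.add_lt_add_left hb2 hn
      _ ≤ _ := by gcongr
  exact h2.ne' (hsum n)

end WeakConvergence

/-! ### From generators to densities and kernels. -/

section DensityConvergence

namespace IsArchimedeanGenerator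

variable {ψ : ℝ → ℝ} {ψs : ℕ → ℝ → ℝ} {k : ℕ}

theorem tendsto_tailDensity (h : IsArchimedeanGenerator ψ)
    (hs : ∀ n, IsArchimedeanGenerator (ψs n)) (hm : IsMultiplyMonotone (k + 1) ψ)
    (hms : ∀ n, IsMultiplyMonotone (k + 1) (ψs n))
    (hψ : ∀ z, 0 ≤ z → Tendsto (fun n => ψs n z) atTop (𝓝 (ψ z))) {m : ℕ} (hm0 : 0 < m)
    (hmk : m ≤ k) {z : ℝ} (hz : 0 < z) (hc : ContinuousAt (negLeftDerivIter ψ m) z) {zs : ℕ → ℝ}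
    (hzs : Tendsto zs atTop (𝓝 z)) :
    Tendsto (fun n => tailDensity (ψs n) m (zs n)) atTop (𝓝 (tailDensity ψ m z)) := by
  obtain ⟨m, rfl⟩ := Nat.exists_eq_succ_of_ne_zero hm0.ne'
  rw [tailDensity_of_pos ψ _ hz]
  refine (ENNReal.tendsto_ofReal
    (h.tendsto_negLeftDerivIter hs hm hms hψ hmk hz hc hzs)).congr' ?_
  filter_upwards [hzs.eventually_const_lt hz] with n hn
  rw [tailDensity_of_pos _ _ hn]

theorem toReal_pseudoInverse_pos (h : IsArchimedeanGenerator ψ) {x : I} (hx0 : 0 < x)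
    (hx1 : x < 1) : 0 < (pseudoInverse ψ x).toReal :=
  ENNReal.toReal_pos (h.pseudoInverse_pos ⟨x.2.1, hx1⟩).ne'
    (h.pseudoInverse_ne_top ⟨hx0, x.2.2⟩)

theorem tailDensity_one_pseudoInverse_ne_zero (h : IsArchimedeanGenerator ψ)
    (hm : IsMultiplyMonotone (k + 1) ψ) (hk : 0 < k) {x : I} (hx0 : 0 < x) :
    tailDensity ψ 1 (pseudoInverse ψ x).toReal ≠ 0 := by
  refine h.tailDensity_one_ne_zero hm hk ENNReal.toReal_nonneg ?_
  rw [h.map_toReal_pseudoInverse ⟨hx0, x.2.2⟩]; exact hx0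

/-- `2 ≤ k` makes `-ψ'` continuous, so the denominators converge at every interior point; only the
factor of order `k` requires a continuity point. -/
theorem tendsto_archimedeanDensity (h : IsArchimedeanGenerator ψ)
    (hs : ∀ n, IsArchimedeanGenerator (ψs n)) (hm : IsMultiplyMonotone (k + 1) ψ)
    (hms : ∀ n, IsMultiplyMonotone (k + 1) (ψs n))
    (hψ : ∀ z, 0 ≤ z → Tendsto (fun n => ψs n z) atTop (𝓝 (ψ z))) (hk : 2 ≤ k)
    {x : Fin k → I} (hx : ∀ i, 0 < x i ∧ x i < 1) {w : ℝ} (hw : 0 ≤ w) {ws : ℕ → ℝ}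
    (hws : Tendsto ws atTop (𝓝 w))
    (hc : ContinuousAt (negLeftDerivIter ψ k) (w + ∑ i, (pseudoInverse ψ (x i)).toReal)) :
    Tendsto (fun n => archimedeanDensity (ψs n) 0 k (ws n) x) atTop
      (𝓝 (archimedeanDensity ψ 0 k w x)) := by
  have hk0 : 0 < k := by omega
  have hφ : ∀ i, Tendsto (fun n => (pseudoInverse (ψs n) (x i)).toReal) atTop
      (𝓝 (pseudoInverse ψ (x i)).toReal) := fun i =>
    (ENNReal.tendsto_toReal (h.pseudoInverse_ne_top ⟨(hx i).1, (x i).2.2⟩)).comp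
      (h.tendsto_pseudoInverse hs hψ ⟨(hx i).1, (x i).2.2⟩)
  have hpos : ∀ i, 0 < (pseudoInverse ψ (x i)).toReal := fun i =>
    h.toReal_pseudoInverse_pos (hx i).1 (hx i).2
  have hsum : 0 < w + ∑ i, (pseudoInverse ψ (x i)).toReal :=
    add_pos_of_nonneg_of_pos hw (Finset.sum_pos (fun i _ => hpos i) ⟨⟨0, hk0⟩, Finset.mem_univ _⟩)
  have h1 : ∀ i, Tendsto (fun n => (tailDensity (ψs n) 1 (pseudoInverse (ψs n) (x i)).toReal)⁻¹)
      atTop (𝓝 (tailDensity ψ 1 (pseudoInverse ψ (x i)).toReal)⁻¹) := fun i =>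
    tendsto_inv_iff.2 (h.tendsto_tailDensity hs hm hms hψ one_pos (by omega) (hpos i)
      (((h.convexOn_negLeftDerivIter hm hk).continuousOn isOpen_Ioi).continuousAt
        (Ioi_mem_nhds (hpos i))) (hφ i))
  have h1t : ∀ i, (tailDensity ψ 1 (pseudoInverse ψ (x i)).toReal)⁻¹ ≠ ∞ := fun i =>
    ENNReal.inv_ne_top.2 (h.tailDensity_one_pseudoInverse_ne_zero hm hk0 (hx i).1)
  have h2 := h.tendsto_tailDensity hs hm hms hψ hk0 le_rfl hsum hc
    (hws.add (tendsto_finsetSum Finset.univ fun i _ => hφ i))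
  simp only [archimedeanDensity, zero_add]
  refine ENNReal.Tendsto.mul (ENNReal.tendsto_finsetProd_of_ne_top _ (fun i _ => h1 i)
    fun i _ => h1t i) (Or.inr ?_) h2 (Or.inr (ENNReal.prod_ne_top fun i _ => h1t i))
  rw [tailDensity_of_pos ψ _ hsum]; exact ENNReal.ofReal_ne_top

theorem ae_mem_Ioo (k : ℕ) : ∀ᵐ x : Fin k → I, ∀ i, 0 < x i ∧ x i < 1 := by
  rw [ae_all_iff]
  intro i
  have h1 : ∀ᵐ y : I, 0 < y ∧ y < 1 := by
    have hne1 : ∀ᵐ x : I, x ≠ 1 := by simp [ae_iff]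
    have hne0 : ∀ᵐ x : I, x ≠ 0 := by simp [ae_iff]
    filter_upwards [hne1, hne0] with x hx1 hx0
    exact ⟨lt_of_le_of_ne unitInterval.nonneg' (Ne.symm hx0),
      lt_of_le_of_ne unitInterval.le_one' hx1⟩
  exact (Measure.tendsto_eval_ae_ae (μ := fun _ : Fin k => (volume : Measure I))).eventually h1

/-- The candidate densities converge almost everywhere. -/
theorem ae_tendsto_archimedeanDensity (h : IsArchimedeanGenerator ψ)
    (hs : ∀ n, IsArchimedeanGenerator (ψs n)) (hm : IsMultiplyMonotone (k + 1) ψ)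
    (hms : ∀ n, IsMultiplyMonotone (k + 1) (ψs n))
    (hψ : ∀ z, 0 ≤ z → Tendsto (fun n => ψs n z) atTop (𝓝 (ψ z))) (hk : 2 ≤ k) {w : ℝ}
    (hw : 0 ≤ w) {ws : ℕ → ℝ} (hws : Tendsto ws atTop (𝓝 w)) :
    ∀ᵐ x : Fin k → I, Tendsto (fun n => archimedeanDensity (ψs n) 0 k (ws n) x) atTop
      (𝓝 (archimedeanDensity ψ 0 k w x)) := by
  have hk0 : 0 < k := by omega
  have hcount := (h.antitoneOn_negLeftDerivIter hm le_rfl).countable_not_continuousWithinAt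
  filter_upwards [ae_mem_Ioo k, h.ae_sum_pseudoInverse_notMem hk0 hcount w] with x hx hxs
  refine h.tendsto_archimedeanDensity hs hm hms hψ hk hx hw hws ?_
  have hsum : 0 < w + ∑ i, (pseudoInverse ψ (x i)).toReal :=
    add_pos_of_nonneg_of_pos hw (Finset.sum_pos
      (fun i _ => h.toReal_pseudoInverse_pos (hx i).1 (hx i).2) ⟨⟨0, hk0⟩, Finset.mem_univ _⟩)
  by_contra hcon
  exact hxs ⟨hsum, fun hcw => hcon (hcw.continuousAt (Ioi_mem_nhds hsum))⟩

end IsArchimedeanGenerator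

namespace Copula

variable {k : ℕ} {C : Copula (k + 1)} {Cs : ℕ → Copula (k + 1)} {ψ : ℝ → ℝ} {ψs : ℕ → ℝ → ℝ}

theorem ae_tendsto_initDensity (hC : C.IsArchimedeanWith ψ)
    (hCs : ∀ n, (Cs n).IsArchimedeanWith (ψs n)) (hk : 2 ≤ k)
    (hψ : ∀ z, 0 ≤ z → Tendsto (fun n => ψs n z) atTop (𝓝 (ψ z))) :
    ∀ᵐ x : Fin k → I, Tendsto (fun n => (Cs n).initDensity x) atTop (𝓝 (C.initDensity x)) := by
  have hk0 : 0 < k := by omega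
  have hn : ∀ᵐ x : Fin k → I, ∀ n, (Cs n).initDensity x = archimedeanDensity (ψs n) 0 k 0 x :=
    ae_all_iff.2 fun n => (hCs n).initDensity_ae_eq hk0
  filter_upwards [hC.generator.ae_tendsto_archimedeanDensity (fun n => (hCs n).generator)
    hC.isMultiplyMonotone (fun n => (hCs n).isMultiplyMonotone) hψ hk le_rfl tendsto_const_nhds,
    hC.initDensity_ae_eq hk0, hn] with x hx hx0 hxn
  rw [hx0]
  exact hx.congr fun n => (hxn n).symm

theorem weaklyConditionalTendsto_of_generator (hC : C.IsArchimedeanWith ψ)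
    (hCs : ∀ n, (Cs n).IsArchimedeanWith (ψs n)) (hk : 2 ≤ k)
    (hψ : ∀ z, 0 ≤ z → Tendsto (fun n => ψs n z) atTop (𝓝 (ψ z)))
    {K : Kernel (Fin k → I) I} {Ks : ℕ → Kernel (Fin k → I) I}
    [IsMarkovKernel K] [∀ n, IsMarkovKernel (Ks n)]
    (hK : C.IsMarkovKernelOf K) (hKs : ∀ n, (Cs n).IsMarkovKernelOf (Ks n)) :
    WeaklyConditionalTendsto Ks C K := by
  have hk0 : 0 < k := by omega
  have hg := hC.generator
  have hgs := fun n => (hCs n).generator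
  have hm := hC.isMultiplyMonotone
  have hms := fun n => (hCs n).isMultiplyMonotone
  obtain ⟨Q₀, hQ₀c, hQ₀d⟩ := TopologicalSpace.exists_countable_dense I
  have hQc : (insert 1 Q₀).Countable := hQ₀c.insert 1
  have hvol : ∀ᵐ x : Fin k → I, archimedeanDensity ψ 0 k 0 x ≠ 0 →
      Tendsto (fun n => conditionalLaw (Ks n) x) atTop (𝓝 (conditionalLaw K x)) := by
    have hc : ∀ᵐ x : Fin k → I, archimedeanDensity ψ 0 k 0 x < ∞ := by
      filter_upwards [hC.initDensity_ae_eq hk0,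
        Measure.rnDeriv_lt_top C.initMarginal (volume : Measure (Fin k → I))] with x hx hx'
      rw [← hx]; exact hx'
    have hcn := hg.ae_tendsto_archimedeanDensity hgs hm hms hψ hk le_rfl
      (tendsto_const_nhds (x := (0 : ℝ)))
    have hy : ∀ᵐ x : Fin k → I, ∀ y ∈ insert 1 Q₀, 0 < y →
        Tendsto (fun n => archimedeanDensity (ψs n) 0 k 0 x * Ks n x (Iic y)) atTop
          (𝓝 (archimedeanDensity ψ 0 k 0 x * K x (Iic y))) := by
      rw [ae_ball_iff hQc]
      intro y _
      by_cases hy0 : 0 < y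
      · have hy1 : (y : ℝ) ∈ Ioc (0 : ℝ) 1 := ⟨hy0, y.2.2⟩
        have hw : Tendsto (fun n => (pseudoInverse (ψs n) y).toReal) atTop
            (𝓝 (pseudoInverse ψ y).toReal) :=
          (ENNReal.tendsto_toReal (hg.pseudoInverse_ne_top hy1)).comp
            (hg.tendsto_pseudoInverse hgs hψ hy1)
        filter_upwards [hg.ae_tendsto_archimedeanDensity hgs hm hms hψ hk ENNReal.toReal_nonneg hw,
          hC.kernel_mul_density_ae_eq hk0 hK hy0,
          ae_all_iff.2 fun n => (hCs n).kernel_mul_density_ae_eq hk0 (hKs n) hy0]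
          with x hx hx0 hxn _
        rw [hx0]
        exact hx.congr fun n => (hxn n).symm
      · exact ae_of_all _ fun x hx => absurd hx hy0
    filter_upwards [hc, hcn, hy] with x hxc hxn hxy hx0
    refine tendsto_probabilityMeasure_of_tendsto_Iic (hQ₀d.mono (subset_insert _ _))
      (mem_insert 1 Q₀) fun y hyQ hy0 => ?_
    -- Where the limit density is positive and finite, so eventually are the approximating ones, and
    -- dividing by them isolates the kernels.
    have hdiv := ENNReal.Tendsto.div (hxy y hyQ hy0) (Or.inr hx0) hxn (Or.inl hxc.ne)
    rw [mul_comm, ENNReal.mul_div_cancel_right hx0 hxc.ne] at hdiv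
    refine hdiv.congr' ?_
    filter_upwards [hxn.eventually_ne hx0, hxn.eventually_lt_const hxc] with n hn hn'
    rw [mul_comm, ENNReal.mul_div_cancel_right hn hn'.ne]
    rfl
  have hae : ∀ᵐ x ∂C.initMarginal,
      Tendsto (fun n => conditionalLaw (Ks n) x) atTop (𝓝 (conditionalLaw K x)) := by
    rw [hC.initMarginal_eq, ae_withDensity_iff (hC.measurable_archimedeanDensity hk0 0)]
    exact hvol
  obtain ⟨N, hsub, hmeas, hnull⟩ := exists_measurable_superset_of_null (ae_iff.1 hae)
  refine ⟨Nᶜ, hmeas.compl, (prob_compl_eq_one_iff hmeas).2 hnull, fun x hx => ?_⟩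
  by_contra hcon
  exact hx (hsub hcon)

end Copula

end DensityConvergence

/-! ### From weak conditional convergence back to copulas. -/

section ConditionalToCopula

namespace Copula

variable {k : ℕ}

instance haveLebesgueDecomposition_initMarginal (C : Copula (k + 1)) :
    C.initMarginal.HaveLebesgueDecomposition (volume : Measure (Fin k → I)) :=
  Measure.haveLebesgueDecomposition_of_sigmaFinite _ _

theorem compProd_initMarginal (C : Copula (k + 1)) {K : Kernel (Fin k → I) I}
    (hK : C.IsMarkovKernelOf K) : C.initMarginal ⊗ₘ K = C.splitMeasure := by
  rw [← splitMeasure_fst]; exact hK.disintegrate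

theorem lintegral_initDensity (C : Copula (k + 1)) (hac : C.initMarginal ≪ volume) :
    ∫⁻ x, C.initDensity x = 1 := by
  rw [← setLIntegral_univ, ← withDensity_apply _ MeasurableSet.univ, initDensity,
    Measure.withDensity_rnDeriv_eq _ _ hac, measure_univ]

theorem measure_Iic_eq_lintegral (C : Copula (k + 1)) (hac : C.initMarginal ≪ volume)
    {K : Kernel (Fin k → I) I} [IsMarkovKernel K] (hK : C.IsMarkovKernelOf K)
    (x : Fin (k + 1) → I) :
    C.measure (Iic x) = ∫⁻ t, C.initDensity t *
      (Iic (Fin.init x)).indicator (fun t => K t (Iic (x (Fin.last k)))) t := by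
  have hKm : Measurable fun t => K t (Iic (x (Fin.last k))) := K.measurable_coe measurableSet_Iic
  have h1 := C.splitMeasure_prod_Iic (Fin.init x) (x (Fin.last k))
  rw [Fin.snoc_init_self, ← C.compProd_initMarginal hK,
    Measure.compProd_apply_prod measurableSet_Iic measurableSet_Iic,
    ← lintegral_indicator measurableSet_Iic] at h1
  rw [← h1]
  conv_lhs => rw [← Measure.withDensity_rnDeriv_eq _ _ hac]
  exact lintegral_withDensity_eq_lintegral_mul _ (Measure.measurable_rnDeriv _ _)
    (hKm.indicator measurableSet_Iic)

/-- The last marginal has no atoms; thus `y` is almost surely a continuity point of the conditional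
law, as the portmanteau theorem requires. -/
theorem ae_kernel_singleton (C : Copula (k + 1)) {K : Kernel (Fin k → I) I} [IsMarkovKernel K]
    (hK : C.IsMarkovKernelOf K) (y : I) : ∀ᵐ t ∂C.initMarginal, K t {y} = 0 := by
  have h1 : C.splitMeasure (univ ×ˢ {y}) = 0 := by
    rw [splitMeasure, Measure.map_apply measurable_split
      (MeasurableSet.univ.prod (measurableSet_singleton y))]
    convert! C.measure_setOf_eq_zero (Fin.last k) y using 2
    ext x; simp
  rw [← C.compProd_initMarginal hK,
    Measure.compProd_apply_prod MeasurableSet.univ (measurableSet_singleton y),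
    setLIntegral_univ, lintegral_eq_zero_iff (K.measurable_coe (measurableSet_singleton y))] at h1
  exact h1

/-- Weak conditional convergence together with convergence of the densities of the first
coordinates implies convergence of copulas. -/
theorem tendsto_cdf_of_weaklyConditionalTendsto {C : Copula (k + 1)} {Cs : ℕ → Copula (k + 1)}
    (hac : C.initMarginal ≪ volume) (hacs : ∀ n, (Cs n).initMarginal ≪ volume)
    {K : Kernel (Fin k → I) I} {Ks : ℕ → Kernel (Fin k → I) I}
    [IsMarkovKernel K] [∀ n, IsMarkovKernel (Ks n)]
    (hK : C.IsMarkovKernelOf K) (hKs : ∀ n, (Cs n).IsMarkovKernelOf (Ks n))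
    (hw : WeaklyConditionalTendsto Ks C K)
    (hd : ∀ᵐ x ∂(volume : Measure (Fin k → I)),
      Tendsto (fun n => (Cs n).initDensity x) atTop (𝓝 (C.initDensity x)))
    (x : Fin (k + 1) → I) : Tendsto (fun n => (Cs n).cdf x) atTop (𝓝 (C.cdf x)) := by
  obtain ⟨Λ, hΛm, hΛ1, hΛ⟩ := hw
  set y := x (Fin.last k)
  have hae : ∀ᵐ t ∂C.initMarginal,
      Tendsto (fun n => Ks n t (Iic y)) atTop (𝓝 (K t (Iic y))) := by
    have hmem : ∀ᵐ t ∂C.initMarginal, t ∈ Λ := (mem_ae_iff_prob_eq_one hΛm).2 hΛ1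
    filter_upwards [hmem, C.ae_kernel_singleton hK y] with t ht hty
    refine ProbabilityMeasure.tendsto_measure_of_null_frontier_of_tendsto' (hΛ t ht) ?_
    exact measure_mono_null (frontier_Iic_subset y) hty
  have hdens : volume.withDensity C.initDensity = C.initMarginal :=
    Measure.withDensity_rnDeriv_eq _ _ hac
  have hcm : ∀ C : Copula (k + 1), Measurable C.initDensity := fun C =>
    Measure.measurable_rnDeriv _ _
  rw [← hdens, ae_withDensity_iff (hcm C)] at hae
  -- The copula is the integral of density times `p`. Density times `1 - p` is its complement to
  -- total mass one.
  let p : Kernel (Fin k → I) I → (Fin k → I) → ℝ≥0∞ := fun K =>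
    (Iic (Fin.init x)).indicator fun t => K t (Iic y)
  have hpm : ∀ K : Kernel (Fin k → I) I, Measurable (p K) := fun K =>
    (K.measurable_coe measurableSet_Iic).indicator measurableSet_Iic
  have hp1 : ∀ (K : Kernel (Fin k → I) I) [IsMarkovKernel K] t, p K t ≤ 1 := fun K _ t =>
    indicator_apply_le' (fun _ => prob_le_one) fun _ => zero_le_one
  have hsum : ∀ (C : Copula (k + 1)) (_ : C.initMarginal ≪ volume) (K : Kernel (Fin k → I) I)
      [IsMarkovKernel K],
      (∫⁻ t, C.initDensity t * p K t) + ∫⁻ t, C.initDensity t * (1 - p K t) = 1 :=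
    fun C hac K _ => by
      have hm : Measurable fun t => C.initDensity t * p K t := (hcm C).mul (hpm K)
      rw [← lintegral_add_left hm]
      refine (lintegral_congr fun t => ?_).trans (C.lintegral_initDensity hac)
      rw [← mul_add, add_tsub_cancel_of_le (hp1 K t), mul_one]
  have hconv : ∀ᵐ t : Fin k → I, C.initDensity t ≠ 0 →
      Tendsto (fun n => p (Ks n) t) atTop (𝓝 (p K t)) := by
    filter_upwards [hae] with t ht h0
    by_cases htx : t ∈ Iic (Fin.init x)
    · simpa only [p, indicator_of_mem htx] using ht h0
    · simp only [p, indicator_of_notMem htx]; exact tendsto_const_nhds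
  have hfin : ∀ᵐ t : Fin k → I, C.initDensity t < ∞ := Measure.rnDeriv_lt_top _ _
  -- Where the limit density vanishes nothing is known about the kernels, but factors bounded by 1
  -- cannot keep the products from tending to zero.
  have hmul : ∀ {c : ℝ≥0∞} {cs : ℕ → ℝ≥0∞} {a : ℝ≥0∞} {as : ℕ → ℝ≥0∞}, c < ∞ →
      Tendsto cs atTop (𝓝 c) → (∀ n, as n ≤ 1) → a ≤ 1 →
      (c ≠ 0 → Tendsto as atTop (𝓝 a)) →
      Tendsto (fun n => cs n * as n) atTop (𝓝 (c * a)) := fun {c cs a as} hc hcs has ha h => by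
    by_cases h0 : c = 0
    · subst h0
      rw [zero_mul]
      exact tendsto_of_tendsto_of_tendsto_of_le_of_le tendsto_const_nhds hcs
        (fun n => zero_le) fun n => mul_le_of_le_one_right' (has n)
    · exact ENNReal.Tendsto.mul hcs (Or.inl h0) (h h0) (Or.inr hc.ne)
  have hlim := tendsto_lintegral_of_add_eq_one (μ := (volume : Measure (Fin k → I)))
    (gs := fun n t => (Cs n).initDensity t * p (Ks n) t)
    (hs := fun n t => (Cs n).initDensity t * (1 - p (Ks n) t))
    (g := fun t => C.initDensity t * p K t) (h := fun t => C.initDensity t * (1 - p K t))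
    (fun n => ((hcm _).mul (hpm _)).aemeasurable)
    (fun n => ((hcm _).mul (measurable_const.sub (hpm _))).aemeasurable)
    (by
      filter_upwards [hd, hconv, hfin] with t h1 h2 h3
      exact hmul h3 h1 (fun n => hp1 _ t) (hp1 _ t) h2)
    (by
      filter_upwards [hd, hconv, hfin] with t h1 h2 h3
      exact hmul h3 h1 (fun n => tsub_le_self) tsub_le_self fun h0 =>
        ENNReal.Tendsto.sub tendsto_const_nhds (h2 h0) (Or.inl ENNReal.one_ne_top))
    (fun n => hsum (Cs n) (hacs n) (Ks n)) (hsum C hac K)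
  have hcdf : ∀ (C : Copula (k + 1)) (_ : C.initMarginal ≪ volume) (K : Kernel (Fin k → I) I)
      [IsMarkovKernel K] (_ : C.IsMarkovKernelOf K),
      C.cdf x = (∫⁻ t, C.initDensity t * p K t).toReal := fun C hac K _ hK => by
    rw [cdf, measureReal_def, C.measure_Iic_eq_lintegral hac hK x]
  simp only [hcdf C hac K hK, fun n => hcdf (Cs n) (hacs n) (Ks n) (hKs n)]
  refine (ENNReal.tendsto_toReal ?_).comp hlim
  exact ne_top_of_le_ne_top ENNReal.one_ne_top (le_self_add.trans (hsum C hac K).le)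

theorem IsArchimedeanWith.hasDerivativesAndDensity {C : Copula (k + 1)} {ψ : ℝ → ℝ}
    (hC : C.IsArchimedeanWith ψ) (hk : 0 < k) : C.HasDerivativesAndDensity ψ where
  contDiffOn := hC.generator.contDiffOn hC.isMultiplyMonotone hk
  left z hz := hC.generator.differentiableWithinAt_iteratedDeriv hC.isMultiplyMonotone hk hz
  absolutelyContinuous := by
    rw [hC.initMarginal_eq]; exact withDensity_absolutelyContinuous _ _

end Copula

end ConditionalToCopula

/-- Here `d = k + 1 ≥ 3`, so `k = d - 1` and `k - 1 = d - 2`. The Markov kernels `K`, `Ks n` are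
arbitrary versions. -/
theorem mainTheorem9 (k : ℕ) (hk : 2 ≤ k)
    (C : Copula (k + 1)) (Cs : ℕ → Copula (k + 1))
    (ψ : ℝ → ℝ) (ψs : ℕ → ℝ → ℝ)
    (hC : C.IsArchimedeanWith ψ) (hCs : ∀ n, (Cs n).IsArchimedeanWith (ψs n))
    (K : Kernel (Fin k → I) I) (Ks : ℕ → Kernel (Fin k → I) I)
    [IsMarkovKernel K] [∀ n, IsMarkovKernel (Ks n)]
    (hK : C.IsMarkovKernelOf K) (hKs : ∀ n, (Cs n).IsMarkovKernelOf (Ks n)) :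
    (C.HasDerivativesAndDensity ψ ∧ ∀ n, (Cs n).HasDerivativesAndDensity (ψs n)) ∧
    List.TFAE [
      TendstoUniformly (fun n => (Cs n).cdf) C.cdf atTop,
      ∀ y ∈ Ioc (0 : ℝ) 1,
        Tendsto (fun n => pseudoInverse (ψs n) y) atTop (𝓝 (pseudoInverse ψ y)),
      TendstoUniformlyOn ψs ψ atTop (Ici 0),
      (∀ m ∈ Icc 1 (k - 1), ∀ z ∈ Ioi (0 : ℝ),
        Tendsto (fun n => iteratedDeriv m (ψs n) z) atTop (𝓝 (iteratedDeriv m ψ z))) ∧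
      (∀ z ∈ Ioi (0 : ℝ), ContinuousAt (leftDeriv (iteratedDeriv (k - 1) ψ)) z →
        Tendsto (fun n => leftDeriv (iteratedDeriv (k - 1) (ψs n)) z) atTop
          (𝓝 (leftDeriv (iteratedDeriv (k - 1) ψ) z))),
      Copula.WeaklyConditionalTendsto Ks C K ∧
      (∀ᵐ x ∂(volume : Measure (Fin k → I)),
        Tendsto (fun n => (Cs n).initDensity x) atTop (𝓝 (C.initDensity x)))] := by
  have hk0 : 0 < k := by omega
  have hg := hC.generator
  have hgs := fun n => (hCs n).generator
  have hm := hC.isMultiplyMonotone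
  have hms := fun n => (hCs n).isMultiplyMonotone
  have hD := hC.hasDerivativesAndDensity hk0
  have hDs := fun n => (hCs n).hasDerivativesAndDensity hk0
  refine ⟨⟨hD, hDs⟩, ?_⟩
  tfae_have 1 → 3 := fun h => by
    obtain ⟨n, rfl⟩ := Nat.exists_eq_succ_of_ne_zero hk0.ne'
    exact hg.tendstoUniformlyOn_of_tendsto hgs fun z hz =>
      Copula.tendsto_generator_of_tendsto_cdf hC hCs (fun x => h.tendsto_at x) hz
  tfae_have 3 → 1 := fun h =>
    Copula.tendstoUniformly_cdf (Copula.tendsto_cdf_of_generator hC hCs h)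
  tfae_have 3 → 2 := fun h y hy =>
    hg.tendsto_pseudoInverse hgs (fun z hz => h.tendsto_at hz) hy
  tfae_have 2 → 3 := fun h =>
    hg.tendstoUniformlyOn_of_tendsto hgs fun z hz => hg.tendsto_of_tendsto_pseudoInverse hgs h hz
  tfae_have 3 → 4 := fun h => by
    have hψ : ∀ z, 0 ≤ z → Tendsto (fun n => ψs n z) atTop (𝓝 (ψ z)) := fun z hz => h.tendsto_at hz
    refine ⟨fun m hmk z hz => ?_, fun z hz hc => ?_⟩
    · have hmk' : m < k := by have := hmk.2; omega
      obtain ⟨j, rfl⟩ := Nat.exists_eq_succ_of_ne_zero (Nat.one_le_iff_ne_zero.1 hmk.1)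
      simp only [hg.iteratedDeriv_eqOn hm hmk' hz,
          fun n => (hgs n).iteratedDeriv_eqOn (hms n) hmk' hz]
      exact (hg.tendsto_negLeftDerivIter hgs hm hms hψ (Nat.lt_of_succ_lt hmk') hz
        (((hg.convexOn_negLeftDerivIter hm hmk').continuousOn isOpen_Ioi).continuousAt
          (Ioi_mem_nhds hz)) tendsto_const_nhds).const_mul _
    · have hz0 : (0 : ℝ) < z := hz
      have hcz : ContinuousAt (negLeftDerivIter ψ k) z := by
        refine (hc.const_mul ((-1 : ℝ) ^ k)).congr ?_
        filter_upwards [Ioi_mem_nhds hz0] with w hw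
        rw [hg.leftDeriv_iteratedDeriv hm hk0 hw, ← mul_assoc, ← mul_pow]
        norm_num
      obtain ⟨j, rfl⟩ := Nat.exists_eq_succ_of_ne_zero hk0.ne'
      simp only [hg.leftDeriv_iteratedDeriv hm hk0 hz0,
        fun n => (hgs n).leftDeriv_iteratedDeriv (hms n) hk0 hz0]
      exact (hg.tendsto_negLeftDerivIter hgs hm hms hψ (Nat.lt_succ_self j) hz0 hcz
        tendsto_const_nhds).const_mul _
  tfae_have 4 → 3 := fun h => by
    refine hg.tendstoUniformlyOn_of_tendsto hgs fun z hz =>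
      hg.tendsto_of_tendsto_leftDeriv hgs (hg.convexOn_negLeftDerivIter hm hk0)
        (fun n => (hgs n).convexOn_negLeftDerivIter (hms n) hk0) (fun z hz => ?_) hz
    -- First derivatives alone suffice; order 1 is among the listed ones because `2 ≤ k`.
    have h1 := h.1 1 ⟨le_rfl, by omega⟩ z hz
    have h2 : ∀ {f : ℝ → ℝ} (_ : IsArchimedeanGenerator f) (_ : IsMultiplyMonotone (k + 1) f),
        iteratedDeriv 1 f z = leftDeriv f z := fun {f} hf hmf => by
      rw [hf.iteratedDeriv_eqOn hmf hk hz]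
      simp [negLeftDerivIter]
    simpa only [h2 hg hm, fun n => h2 (hgs n) (hms n)] using h1
  tfae_have 3 → 5 := fun h =>
    ⟨Copula.weaklyConditionalTendsto_of_generator hC hCs hk (fun z hz => h.tendsto_at hz) hK hKs,
      Copula.ae_tendsto_initDensity hC hCs hk fun z hz => h.tendsto_at hz⟩
  tfae_have 5 → 1 := fun h => Copula.tendstoUniformly_cdf
    (Copula.tendsto_cdf_of_weaklyConditionalTendsto hD.absolutelyContinuous
      (fun n => (hDs n).absolutelyContinuous) hK hKs h.1 h.2)
  tfae_finish
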